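/- **Setting.** Let $V$ be a finite-dimensional real vector space with a symplectic form $\omega$ (a nondegenerate antisymmetric bilinear form). Let $\mathrm{Sp}(V,\omega)\subset \mathrm{GL}(V)$ be the group of linear maps preserving $\omega$. For a symplectic space $(W,\sigma)$ let $\Lambda(W,\sigma)$ be the space of its Lagrangian subspaces (subspaces of dimension $\tfrac12\dim W$ on which $\sigma$ vanishes), with the topology induced from the Grassmannian. For a symmetric bilinear form $B$ put $\mathrm{sign}(B)=n_-(B)-n_+(B)$, where $n_-(B)$ and $n_+(B)$ are the largest dimensions of subspaces on which $B$ is negative, respectively positive, definite. If $L_0,L_1\in\Lambda(W,\sigma)$ are complementary and $L\in\Lambda(W,\sigma)$ is transverse to $L_1$, then $L$ is the graph of a unique linear map $T:L_0\to L_1$, and $\varphi_{L_0,L_1}(L)$ denotes the symmetric bilinear form $\sigma(T\cdot,\cdot)|_{L_0\times L_0}$. *Maslov index.* For $L_0\in\Lambda(W,\sigma)$, the $L_0$-Maslov index $\mu_{L_0}$ is the unique $\tfrac12\mathbb Z$-valued function of fixed-endpoint homotopy classes of continuous paths in $\Lambda(W,\sigma)$ that is additive under concatenation and satisfies $$\mu_{L_0}([\gamma])=\tfrac12\,\mathrm{sign}\big(\varphi_{L_0,L_1}(\gamma(1))\big)-\tfrac12\,\mathrm{sign}\big(\varphi_{L_0,L_1}(\gamma(0))\big)$$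 for every Lagrangian $L_1$ transverse to $L_0$ and every continuous path $\gamma:[0,1]\to\Lambda(W,\sigma)$ of Lagrangians transverse to $L_1$. *Hörmander index.* For $L_0,L_1,L_0',L_1'\in\Lambda(W,\sigma)$ put $\mathfrak q(L_0,L_1;L_0',L_1')=\mu_{L_1}(\gamma)-\mu_{L_0}(\gamma)$, where $\gamma$ is any continuous path in $\Lambda(W,\sigma)$ from $L_0'$ to $L_1'$. *Conley–Zehnder index.* Equip $V^2=V\oplus V$ with the symplectic form $\omega^2\big((v_1,v_2),(w_1,w_2)\big)=\omega(v_1,w_1)-\omega(v_2,w_2)$. For $\phi\in\mathrm{Sp}(V,\omega)$ let $\mathrm{Gr}(\phi)=\{(v,\phi v):v\in V\}\in\Lambda(V^2,\omega^2)$, and let $\Delta=\mathrm{Gr}(\mathrm{Id})$. For a continuous path $\Phi:[0,1]\to\mathrm{Sp}(V,\omega)$ let $\mathfrak i_{\mathrm{CZ}}(\Phi)=\mu_\Delta\big(t\mapsto\mathrm{Gr}(\Phi(t))\big)$. **Statement.** In $(V^2,\omega^2)$ these indices are well defined: for every $L_0\in\Lambda(V^2,\omega^2)$ there is exactly one function $\mu_{L_0}$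 as above, and for all $L_0,L_1,L_0',L_1'\in\Lambda(V^2,\omega^2)$ there is a continuous path $\gamma$ from $L_0'$ to $L_1'$ and $\mu_{L_1}(\gamma)-\mu_{L_0}(\gamma)$ does not depend on its choice. Given continuous paths $\Phi_1,\Phi_2:[0,1]\to\mathrm{Sp}(V,\omega)$, with pointwise product $(\Phi_1\cdot\Phi_2)(t)=\Phi_1(t)\Phi_2(t)$, $$\mathfrak i_{\mathrm{CZ}}(\Phi_1\cdot\Phi_2)=\mathfrak i_{\mathrm{CZ}}(\Phi_1)+\mathfrak i_{\mathrm{CZ}}(\Phi_2)+\mathfrak q\big(\Delta,\mathrm{Gr}(\Phi_2(0)^{-1});\mathrm{Gr}(\Phi_1(0)),\mathrm{Gr}(\Phi_1(1))\big)+\mathfrak q\big(\Delta,\mathrm{Gr}(\Phi_1(1)^{-1});\mathrm{Gr}(\Phi_2(0)),\mathrm{Gr}(\Phi_2(1))\big).$$ In particular, if $\Phi_2$ is a loop based at the identity of $\mathrm{Sp}(V,\omega)$ that is homotopic, with fixed endpoints, to the constant loop, then $\mathfrak i_{\mathrm{CZ}}(\Phi_1\cdot\Phi_2)=\mathfrak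 i_{\mathrm{CZ}}(\Phi_1)$. -/

import Mathlib

open scoped unitInterval

noncomputable section

/-- A symplectic form: a nondegenerate alternating bilinear form on a real vector space. -/
structure SymplecticForm (V : Type*) [AddCommGroup V] [Module ℝ V] where
  form : LinearMap.BilinForm ℝ V
  isAlt : form.IsAlt
  nondegenerate : form.Nondegenerate

namespace SymplecticForm

/-- The symplectic form `ω ⊕ (-ω)` on `V × V`:
`((v₁, v₂), (w₁, w₂)) ↦ ω(v₁, w₁) - ω(v₂, w₂)`. -/
def double {V : Type*} [AddCommGroup V] [Module ℝ V] (ω : SymplecticForm V) :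
    SymplecticForm (V × V) where
  form := ω.form.compl₁₂ (LinearMap.fst ℝ V V) (LinearMap.fst ℝ V V)
    - ω.form.compl₁₂ (LinearMap.snd ℝ V V) (LinearMap.snd ℝ V V)
  isAlt := by
    intro x
    simp [ω.isAlt.self_eq_zero]
  nondegenerate := by
    constructor
    · intro x hx
      refine Prod.ext (ω.nondegenerate.1 _ fun y => ?_) (ω.nondegenerate.1 _ fun y => ?_)
      · simpa using hx (y, 0)
      · simpa using hx (0, y)
    · intro x hx
      refine Prod.ext (ω.nondegenerate.2 _ fun y => ?_) (ω.nondegenerate.2 _ fun y => ?_)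
      · simpa using hx (y, 0)
      · simpa using hx (0, y)

theorem double_apply {V : Type*} [AddCommGroup V] [Module ℝ V] (ω : SymplecticForm V)
    (v w : V × V) : ω.double.form v w = ω.form v.1 w.1 - ω.form v.2 w.2 := by
  simp [double]

end SymplecticForm

/-- The symplectic group of `(V, ω)`, a subgroup of `GL(V)` with the subspace topology. -/
def Sp {V : Type*} [NormedAddCommGroup V] [NormedSpace ℝ V] (ω : SymplecticForm V) :
    Subgroup (V →L[ℝ] V)ˣ where
  carrier := {g | ∀ v w, ω.form (g.val v) (g.val w) = ω.form v w}
  one_mem' := by intro v w; simp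
  mul_mem' := by
    intro g h hg hh v w
    simpa using (hg (h.val v) (h.val w)).trans (hh v w)
  inv_mem' := by
    intro g hg v w
    have key : ∀ x, g.val ((g⁻¹).val x) = x := fun x => by
      exact congrArg (fun f : V →L[ℝ] V => f x) g.mul_inv
    have := hg ((g⁻¹).val v) ((g⁻¹).val w)
    rw [key, key] at this
    exact this.symm

/-- The topology of the (disjoint union over `k` of the) Grassmannians of `k`-dimensional subspaces:
the quotient topology under `span` from the spaces of linearly independent `k`-frames. -/
@[reducible]
def grassmannTopology (W : Type*) [NormedAddCommGroup W] [NormedSpace ℝ W] :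
    TopologicalSpace (Submodule ℝ W) :=
  TopologicalSpace.coinduced
    (fun f : Σ k : ℕ, {f : Fin k → W // LinearIndependent ℝ f} =>
      Submodule.span ℝ (Set.range f.2.1)) inferInstance

/-- The set `Λ(W, ω)` of Lagrangian subspaces: isotropic of half the dimension. -/
@[ext]
structure Lagrangian {W : Type*} [AddCommGroup W] [Module ℝ W] (ω : SymplecticForm W) where
  space : Submodule ℝ W
  two_mul_finrank : 2 * Module.finrank ℝ space = Module.finrank ℝ W
  isotropic : ∀ x ∈ space, ∀ y ∈ space, ω.form x y = 0

/-- `Λ(W, ω)` carries the subspace topology from the Grassmannian. -/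
instance Lagrangian.instTopologicalSpace {W : Type*} [NormedAddCommGroup W] [NormedSpace ℝ W]
    (ω : SymplecticForm W) : TopologicalSpace (Lagrangian ω) :=
  TopologicalSpace.induced Lagrangian.space (grassmannTopology W)

section Chart

variable {W : Type*} [AddCommGroup W] [Module ℝ W]

/-- For `L` complementary to `L₁`, the linear map `T : L₀ → L₁` with `u + T u ∈ L` for all
`u ∈ L₀`; if `L₀` is also complementary to `L₁`, then `L` is the graph of `T`
(see `mem_iff_exists_graphMap`). -/
def graphMap (L₀ L₁ L : Submodule ℝ W) (h : IsCompl L L₁) : L₀ →ₗ[ℝ] L₁ :=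
  -((L₁.projectionOnto L h.symm).comp L₀.subtype)

theorem add_graphMap_mem (L₀ L₁ L : Submodule ℝ W) (h : IsCompl L L₁) (u : L₀) :
    (u : W) + (graphMap L₀ L₁ L h u : W) ∈ L := by
  rw [← Submodule.projectionOnto_apply_eq_zero_iff h.symm, map_add,
    Submodule.projectionOnto_apply_left]
  simp [graphMap]

theorem mem_iff_exists_graphMap (L₀ L₁ L : Submodule ℝ W) (h₀ : IsCompl L₀ L₁)
    (h : IsCompl L L₁) (x : W) :
    x ∈ L ↔ ∃ u : L₀, (u : W) + (graphMap L₀ L₁ L h u : W) = x := by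
  constructor
  · intro hx
    obtain ⟨u, hu, v, hv, rfl⟩ : ∃ u ∈ L₀, ∃ v ∈ L₁, u + v = x := by
      have : x ∈ L₀ ⊔ L₁ := by rw [h₀.sup_eq_top]; trivial
      exact Submodule.mem_sup.1 this
    refine ⟨⟨u, hu⟩, ?_⟩
    have h1 := add_graphMap_mem L₀ L₁ L h ⟨u, hu⟩
    have h2 := L.sub_mem h1 hx
    have h3 : (graphMap L₀ L₁ L h ⟨u, hu⟩ : W) - v ∈ L := by simpa using h2
    have h4 : (graphMap L₀ L₁ L h ⟨u, hu⟩ : W) - v ∈ L₁ := L₁.sub_mem (Subtype.mem _) hv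
    have h5 := Submodule.disjoint_def.1 h.disjoint _ h3 h4
    rw [sub_eq_zero.1 h5]
  · rintro ⟨u, rfl⟩
    exact add_graphMap_mem L₀ L₁ L h u

/-- The chart `φ_{L₀,L₁}(L)`: the bilinear form `(u, v) ↦ ω(T u, v)` on `L₀`, where `L` is the
graph of `T : L₀ → L₁`. -/
def chartForm (ω : SymplecticForm W) (L₀ L₁ L : Submodule ℝ W) (h : IsCompl L L₁) :
    LinearMap.BilinForm ℝ L₀ :=
  ω.form.compl₁₂ (L₁.subtype.comp (graphMap L₀ L₁ L h)) L₀.subtype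

theorem chartForm_apply (ω : SymplecticForm W) (L₀ L₁ L : Submodule ℝ W) (h : IsCompl L L₁)
    (u v : L₀) : chartForm ω L₀ L₁ L h u v = ω.form (graphMap L₀ L₁ L h u) v := rfl

/-- The signature of a symmetric bilinear form, with the convention index minus coindex. -/
def bilinSign (B : LinearMap.BilinForm ℝ W) : ℤ :=
  (sigNeg B.toQuadraticMap : ℤ) - (sigPos B.toQuadraticMap : ℤ)

end Chart

section Maslov

variable {W : Type*} [NormedAddCommGroup W] [NormedSpace ℝ W]

/-- `μ`, a function of fixed-endpoint homotopy classes of paths in `Λ(W, ω)`, is a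
`½ℤ`-valued homomorphism on the fundamental groupoid of `Λ(W, ω)`, and it is given by half the
difference of the signatures of `φ_{L₀,L₁}` at the endpoints for every path of Lagrangians transverse
to a fixed Lagrangian `L₁`, itself transverse to `L₀`. -/
structure IsMaslovIndex (ω : SymplecticForm W) (L₀ : Lagrangian ω)
    (μ : ∀ A B : Lagrangian ω, Path.Homotopic.Quotient A B → ℚ) : Prop where
  half_integer : ∀ A B (c : Path.Homotopic.Quotient A B), ∃ k : ℤ, μ A B c = (k : ℚ) / 2
  map_trans : ∀ A B C (c : Path.Homotopic.Quotient A B) (d : Path.Homotopic.Quotient B C),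
    μ A C (c.trans d) = μ A B c + μ B C d
  chart : ∀ L₁ : Lagrangian ω, IsCompl L₀.space L₁.space →
    ∀ A B (γ : Path A B) (h : ∀ t, IsCompl (γ t).space L₁.space),
      μ A B (Path.Homotopic.Quotient.mk γ) =
        (bilinSign (chartForm ω L₀.space L₁.space (γ 1).space (h 1)) : ℚ) / 2
          - (bilinSign (chartForm ω L₀.space L₁.space (γ 0).space (h 0)) : ℚ) / 2

/-- The `L₀`-Maslov index of a path: the value on its homotopy class of the homomorphism
characterized by `IsMaslovIndex ω L₀`. -/
def maslovIndex (ω : SymplecticForm W) (L₀ : Lagrangian ω) {A B : Lagrangian ω}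
    (γ : Path A B) : ℚ :=
  Classical.epsilon (IsMaslovIndex ω L₀) A B (Path.Homotopic.Quotient.mk γ)

/-- The Hörmander index `q(L₀, L₁; L₀', L₁')`: the common value of `μ_{L₁}(γ) - μ_{L₀}(γ)` for all
continuous paths `γ` of Lagrangians from `L₀'` to `L₁'`. -/
def hormanderIndex (ω : SymplecticForm W) (L₀ L₁ L₀' L₁' : Lagrangian ω) : ℚ :=
  Classical.epsilon fun r : ℚ =>
    ∀ γ : Path L₀' L₁', r = maslovIndex ω L₁ γ - maslovIndex ω L₀ γ

end Maslov

section ConleyZehnder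

variable {V : Type*} [NormedAddCommGroup V] [NormedSpace ℝ V] [FiniteDimensional ℝ V]

/-- The graph `{(v, g v)}` of a symplectic map, a Lagrangian subspace of `(V × V, ω ⊕ (-ω))`. -/
def graphLagrangian (ω : SymplecticForm V) (g : Sp ω) : Lagrangian ω.double where
  space := (g.1.val : V →ₗ[ℝ] V).graph
  two_mul_finrank := by
    rw [Module.finrank_prod, LinearMap.graph_eq_range_prod, LinearMap.finrank_range_of_inj]
    · ring
    · intro x y hxy
      exact congrArg Prod.fst hxy
  isotropic := by
    intro x hx y hy
    rw [LinearMap.mem_graph_iff] at hx hy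
    rw [SymplecticForm.double_apply, hx, hy]
    exact sub_eq_zero.2 (g.2 x.1 y.1).symm

theorem continuous_graphLagrangian (ω : SymplecticForm V) : Continuous (graphLagrangian ω) := by
  refine continuous_induced_rng.2 ?_
  let b := Module.finBasis ℝ V
  have hli : ∀ g : Sp ω, LinearIndependent ℝ (fun i => (b i, g.1.val (b i))) := fun g =>
    LinearIndependent.of_comp (LinearMap.fst ℝ V V) b.linearIndependent
  let F : Sp ω → Σ k : ℕ, {f : Fin k → V × V // LinearIndependent ℝ f} := fun g => ⟨_, _, hli g⟩
  have hF : Continuous F := by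
    refine continuous_sigmaMk.comp (Continuous.subtype_mk (continuous_pi fun i => ?_) _)
    refine continuous_const.prodMk ?_
    exact (Units.continuous_val.comp continuous_subtype_val).clm_apply continuous_const
  have hcomp : (Lagrangian.space ∘ graphLagrangian ω : Sp ω → Submodule ℝ (V × V)) =
      (fun f : Σ k : ℕ, {f : Fin k → V × V // LinearIndependent ℝ f} =>
        Submodule.span ℝ (Set.range f.2.1)) ∘ F := by
    funext g
    have h : (fun i => (b i, g.1.val (b i))) =
        (LinearMap.id.prod (g.1.val : V →ₗ[ℝ] V)) ∘ b := rfl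
    simp only [Function.comp_apply, F, graphLagrangian]
    rw [h, Set.range_comp, ← Submodule.map_span, b.span_eq, LinearMap.graph_eq_range_prod,
      LinearMap.range_eq_map]
  rw [hcomp]
  let _ := grassmannTopology (V × V)
  exact continuous_coinduced_rng.comp hF

/-- The path `t ↦ Gr(Φ(t))` of Lagrangians. -/
def graphPath (ω : SymplecticForm V) (Φ : C(I, Sp ω)) :
    Path (graphLagrangian ω (Φ 0)) (graphLagrangian ω (Φ 1)) where
  toFun t := graphLagrangian ω (Φ t)
  continuous_toFun := (continuous_graphLagrangian ω).comp Φ.continuous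
  source' := rfl
  target' := rfl

/-- The diagonal `Δ` of `V × V`, as the graph of the identity. -/
def diagLagrangian (ω : SymplecticForm V) : Lagrangian ω.double := graphLagrangian ω 1

/-- The Conley–Zehnder index of a continuous path of symplectic maps: the `Δ`-Maslov index of
the path of graphs. -/
def conleyZehnderIndex (ω : SymplecticForm V) (Φ : C(I, Sp ω)) : ℚ :=
  maslovIndex ω.double (diagLagrangian ω) (graphPath ω Φ)

end ConleyZehnder

end

/-! The Maslov index with respect to `L₀` is the increment of a multivalued function on the
Lagrangian Grassmannian. Its local branches are half the signatures in the charts `φ_{L₀,N}`, for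
`N` complementary to `L₀`.

Two branches differ by a locally constant function. With an auxiliary Lagrangian `N` complementary
to all the others, the Kashiwara index of `(L₀, M, L)` is a cyclic sum of signatures in charts along
`N` (`kashiwaraIndex_eq_chartSign`), and it is also the signature of `L` in the chart `(L₀, M)`
(`kashiwaraIndex_of_isCompl`). Comparing `M` with `M'` leaves constants and signatures of forms that
stay nondegenerate while `L` stays transverse to `M` and `M'` (`eventually_chartSign_eq`).

Branches with this property form a bundle with discrete fibre, that is, a covering. Path lifting
gives existence and homotopy invariance of the index; additivity and locality give uniqueness.
Replacing `L₀` by `L₁` changes the branches, up to local constants, by half of a Kashiwara index, a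
genuine function of `L`; so the Hörmander index depends only on endpoints
(`maslovIndex_sub_maslovIndex`).

For the product formula, the diagonal of the square `(s, t) ↦ Gr(Φ₁(s)Φ₂(t))` is homotopic to two
consecutive edges. Symplectic invariance (`maslovIndex_map`) turns these edges into the graph paths
of `Φ₁` and `Φ₂` with moved reference Lagrangians, and Hörmander indices restore the reference `Δ`.
-/

/-! ### Multivalued functions, primitives along paths and coverings. -/

section LocalPrimitives

open Topology Filter

/-- An open cover of `X` with functions on its members whose differences are locally constant on
overlaps. -/
structure LocalPrimitives (X : Type*) [TopologicalSpace X] (ι : Type*) (A : Type*)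
    [AddCommGroup A] where
  dom : ι → Set X
  isOpen_dom : ∀ i, IsOpen (dom i)
  cover : ∀ x, ∃ i, x ∈ dom i
  val : ι → X → A
  overlap : ∀ i j, ∀ x ∈ dom i ∩ dom j, ∀ᶠ y in 𝓝 x, val i y - val j y = val i x - val j x

namespace LocalPrimitives

variable {X Y ι A : Type*} [TopologicalSpace X] [TopologicalSpace Y] [AddCommGroup A]
  (P : LocalPrimitives X ι A)

/-- `F` differs from the pullbacks along `g` of the local functions by locally constant functions. -/
def IsPrimitiveAlong (g : Y → X) (F : Y → A) : Prop :=
  ∀ y, ∃ i, g y ∈ P.dom i ∧ ∀ᶠ z in 𝓝 y, F z - P.val i (g z) = F y - P.val i (g y)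

variable {P}

theorem IsPrimitiveAlong.comp {Z : Type*} [TopologicalSpace Z] {g : Y → X} {F : Y → A}
    (hF : P.IsPrimitiveAlong g F) {k : Z → Y} (hk : Continuous k) :
    P.IsPrimitiveAlong (g ∘ k) (F ∘ k) := fun z => by
  obtain ⟨i, hi, h⟩ := hF (k z)
  exact ⟨i, hi, hk.continuousAt.eventually h⟩

/-- The overlap condition upgrades the single index in the definition to every index whose domain
contains the point. -/
theorem IsPrimitiveAlong.eventually {g : Y → X} (hg : Continuous g) {F : Y → A}
    (hF : P.IsPrimitiveAlong g F) {y : Y} {i : ι} (hi : g y ∈ P.dom i) :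
    ∀ᶠ z in 𝓝 y, F z - P.val i (g z) = F y - P.val i (g y) := by
  obtain ⟨j, hj, h⟩ := hF y
  filter_upwards [h, hg.continuousAt.eventually (P.overlap i j (g y) ⟨hi, hj⟩)] with z h1 h2
  calc F z - P.val i (g z) = (F z - P.val j (g z)) - (P.val i (g z) - P.val j (g z)) := by abel
    _ = _ := by rw [h1, h2]; abel

theorem IsPrimitiveAlong.sub_eq [PreconnectedSpace Y] {g : Y → X} (hg : Continuous g) {F G : Y → A}
    (hF : P.IsPrimitiveAlong g F) (hG : P.IsPrimitiveAlong g G) (y z : Y) :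
    F z - F y = G z - G y := by
  have hloc : IsLocallyConstant fun y => F y - G y := by
    refine IsLocallyConstant.iff_eventually_eq _ |>.2 fun y => ?_
    obtain ⟨i, hi, h⟩ := hF y
    filter_upwards [h, hG.eventually hg hi] with z h1 h2
    calc F z - G z = (F z - P.val i (g z)) - (G z - P.val i (g z)) := by abel
      _ = _ := by rw [h1, h2]; abel
  have := hloc.apply_eq_of_preconnectedSpace y z
  calc F z - F y = (F z - G z) + (G z - F y) := by abel
    _ = _ := by rw [← this]; abel

theorem isPrimitiveAlong_val {g : Y → X} {i : ι} (h : ∀ y, g y ∈ P.dom i) :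
    P.IsPrimitiveAlong g fun y => P.val i (g y) := fun y =>
  ⟨i, h y, by simp⟩

variable (P)

/-- The principal bundle of germs of primitives. -/
noncomputable def core [TopologicalSpace A] [DiscreteTopology A] : FiberBundleCore ι X A where
  baseSet := P.dom
  isOpen_baseSet := P.isOpen_dom
  indexAt x := (P.cover x).choose
  mem_baseSet_at x := (P.cover x).choose_spec
  -- The coordinate `v` over the index `i` stands for the germ of `P.val i + v`, so `v + P.val i x`
  -- does not depend on the index.
  coordChange i j x v := v + (P.val i x - P.val j x)
  coordChange_self i x _ v := by simp
  continuousOn_coordChange i j := by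
    rintro ⟨x, v⟩ ⟨hx, -⟩
    refine ContinuousAt.continuousWithinAt ?_
    refine continuousAt_snd.add ?_
    have : ContinuousAt (fun y => P.val i y - P.val j y) x :=
      continuousAt_const.congr (f := fun _ => P.val i x - P.val j x)
        ((P.overlap i j x hx).mono fun y hy => hy.symm)
    exact ContinuousAt.comp (f := Prod.fst) (x := (x, v)) this continuousAt_fst
  coordChange_comp i j k x _ v := by abel

/-- In a local trivialization the fibre coordinate is continuous into a discrete group, hence
locally constant. -/
theorem isPrimitiveAlong_of_continuous [TopologicalSpace A] [DiscreteTopology A]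
    {Γ : Y → P.core.TotalSpace} (hΓ : Continuous Γ) :
    P.IsPrimitiveAlong (fun y => (Γ y).proj)
      fun y => id (α := A) (Γ y).2 + P.val (P.core.indexAt (Γ y).proj) (Γ y).proj := by
  intro y
  refine ⟨P.core.indexAt (Γ y).proj, P.core.mem_baseSet_at _, ?_⟩
  set i := P.core.indexAt (Γ y).proj
  have h : ContinuousAt (fun z => (P.core.localTriv i (Γ z)).2) y := by
    have h1 : ContinuousAt (P.core.localTriv i) (Γ y) :=
      (P.core.localTriv i).continuousAt
        ((P.core.mem_localTriv_source i _).2 (P.core.mem_baseSet_at _))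
    exact continuousAt_snd.comp (h1.comp hΓ.continuousAt)
  have h2 := h.eventually (IsOpen.mem_nhds (isOpen_discrete {(P.core.localTriv i (Γ y)).2}) rfl)
  filter_upwards [h2] with z hz
  have hz' : id (α := A) (Γ z).2 + (P.val (P.core.indexAt (Γ z).proj) (Γ z).proj
      - P.val i (Γ z).proj) = id (α := A) (Γ y).2 + (P.val (P.core.indexAt (Γ y).proj) (Γ y).proj
      - P.val i (Γ y).proj) := hz
  rw [add_sub_assoc, add_sub_assoc]
  exact hz'

/-- Lift a path to the covering and take the increment of the value of the germ. The endpoint of the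
lift is invariant under fixed-endpoint homotopy. -/
theorem exists_map_quotient_isPrimitiveAlong [TopologicalSpace A] [DiscreteTopology A] :
    ∃ m : ∀ a b : X, Path.Homotopic.Quotient a b → A, ∀ a b (γ : Path a b),
      ∃ F : I → A, P.IsPrimitiveAlong γ F ∧ m a b (Path.Homotopic.Quotient.mk γ) = F 1 - F 0 := by
  have cov : IsCoveringMap P.core.proj := FiberBundle.isCoveringMap
  let e : ∀ a : X, P.core.TotalSpace := fun a => ⟨a, (0 : A)⟩
  have hγ : ∀ {a b} (γ : Path a b), γ.toContinuousMap 0 = P.core.proj (e a) := fun γ => γ.source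
  let abs : P.core.TotalSpace → A := fun p => id (α := A) p.2 + P.val (P.core.indexAt p.proj) p.proj
  refine ⟨fun a b c => Quotient.lift
    (fun γ : Path a b => abs (cov.liftPath γ.toContinuousMap (e a) (hγ γ) 1) - abs (e a))
    (fun γ γ' h => ?_) c, fun a b γ => ⟨fun t => abs (cov.liftPath γ.toContinuousMap (e a) (hγ γ) t),
      ?_, ?_⟩⟩
  · rw [cov.liftPath_apply_one_eq_of_homotopicRel h (e a) (hγ γ) (hγ γ')]
  · have h := P.isPrimitiveAlong_of_continuous (cov.liftPath γ.toContinuousMap (e a) (hγ γ)).continuous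
    have h2 := cov.liftPath_lifts γ.toContinuousMap (e a) (hγ γ)
    have h3 : (fun t => (cov.liftPath γ.toContinuousMap (e a) (hγ γ) t).proj) = γ := h2
    rw [h3] at h
    exact h
  · exact congrArg (fun p => abs (cov.liftPath γ.toContinuousMap (e a) (hγ γ) 1) - abs p)
      (cov.liftPath_zero γ.toContinuousMap (e a) (hγ γ)).symm

end LocalPrimitives

/-- A function on homotopy classes of paths that is additive and given on short paths by
differences of the local functions is a primitive along every path. -/
theorem LocalPrimitives.isPrimitiveAlong_subpath {X ι A : Type*} [TopologicalSpace X]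
    [AddCommGroup A] (P : LocalPrimitives X ι A)
    {m : ∀ a b : X, Path.Homotopic.Quotient a b → A}
    (htrans : ∀ a b c (p : Path.Homotopic.Quotient a b) (q : Path.Homotopic.Quotient b c),
      m a c (p.trans q) = m a b p + m b c q)
    (hloc : ∀ a b (γ : Path a b) i, (∀ t, γ t ∈ P.dom i) →
      m a b (Path.Homotopic.Quotient.mk γ) = P.val i b - P.val i a)
    {a b : X} (γ : Path a b) :
    P.IsPrimitiveAlong γ fun t => m (γ 0) (γ t) (Path.Homotopic.Quotient.mk (γ.subpath 0 t)) := by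
  intro t
  obtain ⟨i, hi⟩ := P.cover (γ t)
  refine ⟨i, hi, ?_⟩
  have hnhds : γ ⁻¹' P.dom i ∈ 𝓝 t := γ.continuous.continuousAt ((P.isOpen_dom i).mem_nhds hi)
  -- The interval between `t` and `s` shrinks to `t`, so for `s` near `t` the subpath between them
  -- stays in one domain.
  have hint : Tendsto (fun s => Set.uIcc t s) (𝓝 t) (𝓝 t).smallSets :=
    tendsto_const_nhds.uIcc tendsto_id
  filter_upwards [hint.eventually (eventually_smallSets_subset.2 hnhds)] with s hs
  have h1 := htrans _ _ _ (Path.Homotopic.Quotient.mk (γ.subpath 0 t))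
    (Path.Homotopic.Quotient.mk (γ.subpath t s))
  rw [← Path.Homotopic.Quotient.mk_trans,
    Path.Homotopic.Quotient.eq.2 ⟨Path.Homotopy.subpathTransSubpath γ 0 t s⟩,
    hloc _ _ (γ.subpath t s) i] at h1
  · rw [h1]; abel
  · intro u
    have : γ.subpath t s u ∈ γ '' Set.uIcc t s := by
      rw [← Path.range_subpath]; exact ⟨u, rfl⟩
    obtain ⟨v, hv, hvu⟩ := this
    rw [← hvu]
    exact hs hv

theorem map_quotient_mk_cast {X A : Type*} [TopologicalSpace X]
    (m : ∀ a b : X, Path.Homotopic.Quotient a b → A) {a b a' b' : X} (γ : Path a b) (ha : a' = a)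
    (hb : b' = b) : m a' b' (Path.Homotopic.Quotient.mk (γ.cast ha hb)) =
      m a b (Path.Homotopic.Quotient.mk γ) := by
  subst ha hb
  rfl

/-- This is the source of uniqueness: the values of `m` on initial subpaths form a primitive, and
primitives along a path have equal increments. -/
theorem LocalPrimitives.map_mk_eq_sub {X ι A : Type*} [TopologicalSpace X]
    [AddCommGroup A] (P : LocalPrimitives X ι A)
    {m : ∀ a b : X, Path.Homotopic.Quotient a b → A}
    (htrans : ∀ a b c (p : Path.Homotopic.Quotient a b) (q : Path.Homotopic.Quotient b c),
      m a c (p.trans q) = m a b p + m b c q)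
    (hloc : ∀ a b (γ : Path a b) i, (∀ t, γ t ∈ P.dom i) →
      m a b (Path.Homotopic.Quotient.mk γ) = P.val i b - P.val i a)
    {a b : X} (γ : Path a b) {F : I → A} (hF : P.IsPrimitiveAlong γ F) :
    m a b (Path.Homotopic.Quotient.mk γ) = F 1 - F 0 := by
  have h := hF.sub_eq γ.continuous (P.isPrimitiveAlong_subpath htrans hloc γ) 0 1
  -- The constant path is homotopic to its own square, so additivity forces its value to be `0`.
  have h0 : m (γ 0) (γ 0) (Path.Homotopic.Quotient.mk (γ.subpath 0 0)) = 0 := by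
    have := htrans _ _ _ (Path.Homotopic.Quotient.mk (γ.subpath 0 0))
      (Path.Homotopic.Quotient.mk (γ.subpath 0 0))
    rw [← Path.Homotopic.Quotient.mk_trans,
      Path.Homotopic.Quotient.eq.2 ⟨Path.Homotopy.subpathTransSubpath γ 0 0 0⟩] at this
    simpa using this
  rw [h0, sub_zero, Path.subpath_zero_one, map_quotient_mk_cast m] at h
  exact h.symm

end LocalPrimitives

noncomputable section

/-! ### Signatures of real quadratic forms. -/

section Signature

open Topology Filter Module

variable {E E' : Type*} [AddCommGroup E] [Module ℝ E] [AddCommGroup E'] [Module ℝ E']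

/-- The signature of a quadratic form, with the convention index minus coindex. -/
def qsign (Q : QuadraticForm ℝ E) : ℤ := (sigNeg Q : ℤ) - sigPos Q

theorem qsign_congr {Q : QuadraticForm ℝ E} {Q' : QuadraticForm ℝ E'} (e : E ≃ₗ[ℝ] E')
    (h : ∀ x, Q' (e x) = Q x) : qsign Q = qsign Q' := by
  have he : QuadraticMap.Equivalent Q Q' := ⟨{ e with map_app' := h }⟩
  rw [qsign, qsign, he.sigPos_eq, he.sigNeg_eq]

theorem qsign_neg (Q : QuadraticForm ℝ E) : qsign (-Q) = -qsign Q := by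
  rw [qsign, qsign, sigPos_neg, sigNeg_neg]
  ring

theorem finrank_le_sigPos [FiniteDimensional ℝ E'] (Q : QuadraticForm ℝ E') (f : E →ₗ[ℝ] E')
    (hf : ∀ x, x ≠ 0 → 0 < Q (f x)) : finrank ℝ E ≤ sigPos Q := by
  have hinj : Function.Injective f := by
    rw [injective_iff_map_eq_zero]
    intro x hx
    by_contra h
    simpa [hx] using hf x h
  rw [← LinearMap.finrank_range_of_inj hinj]
  refine le_sigPos_of_posDef Q ?_
  rintro ⟨_, x, rfl⟩ hx
  refine hf x ?_
  rintro rfl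
  simp at hx

theorem sigPos_add_sigPos_le_prod [FiniteDimensional ℝ E] [FiniteDimensional ℝ E']
    (Q : QuadraticForm ℝ E) (Q' : QuadraticForm ℝ E') :
    sigPos Q + sigPos Q' ≤ sigPos (Q.prod Q') := by
  obtain ⟨V, hV, hQ⟩ := exists_finrank_eq_sigPos_and_posDef Q
  obtain ⟨V', hV', hQ'⟩ := exists_finrank_eq_sigPos_and_posDef Q'
  rw [← hV, ← hV', ← finrank_prod]
  refine finrank_le_sigPos _ (V.subtype.prodMap V'.subtype) fun x hx => ?_
  exact QuadraticMap.PosDef.prod hQ hQ' x hx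

theorem finrank_radical_add_le_prod [FiniteDimensional ℝ E] [FiniteDimensional ℝ E']
    (Q : QuadraticForm ℝ E) (Q' : QuadraticForm ℝ E') :
    finrank ℝ Q.radical + finrank ℝ Q'.radical ≤ finrank ℝ (Q.prod Q').radical := by
  rw [← finrank_prod]
  have h : ∀ x : Q.radical × Q'.radical,
      (Q.radical.subtype.prodMap Q'.radical.subtype) x ∈ (Q.prod Q').radical := by
    rintro ⟨⟨x, hx⟩, ⟨y, hy⟩⟩
    rw [QuadraticMap.mem_radical_iff'] at *
    refine ⟨by simp [hx.1, hy.1], fun n => ?_⟩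
    simp [hx.2, hy.2]
  refine LinearMap.finrank_le_finrank_of_injective
    (f := (Q.radical.subtype.prodMap Q'.radical.subtype).codRestrict _ h) ?_
  rw [LinearMap.injective_codRestrict_iff]
  exact Function.Injective.prodMap Subtype.val_injective Subtype.val_injective

/-- Positive index, negative index and dimension of the radical are each superadditive; their sums
are the dimensions, which add, so all three inequalities are equalities. -/
theorem qsign_prod [FiniteDimensional ℝ E] [FiniteDimensional ℝ E']
    (Q : QuadraticForm ℝ E) (Q' : QuadraticForm ℝ E') :
    qsign (Q.prod Q') = qsign Q + qsign Q' := by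
  have h1 := sigPos_add_sigPos_le_prod Q Q'
  have h2 := sigPos_add_sigPos_le_prod (-Q) (-Q')
  have h3 : (-Q).prod (-Q') = -(Q.prod Q') := by
    ext x
    simp [add_comm]
  rw [h3, sigPos_neg, sigPos_neg, sigPos_neg] at h2
  have h4 := finrank_radical_add_le_prod Q Q'
  have h5 := QuadraticForm.sigPos_add_sigNeg_add_radical (Q := Q)
  have h6 := QuadraticForm.sigPos_add_sigNeg_add_radical (Q := Q')
  have h7 := QuadraticForm.sigPos_add_sigNeg_add_radical (Q := Q.prod Q')
  rw [finrank_prod] at h7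
  simp only [qsign]
  omega

theorem qsign_eq_zero_of_neg (Q : QuadraticForm ℝ E) (e : E ≃ₗ[ℝ] E) (h : ∀ x, Q (e x) = -Q x) :
    qsign Q = 0 := by
  have h1 := qsign_congr (Q := -Q) (Q' := Q) e (by simpa using h)
  rw [qsign_neg] at h1
  omega

variable {F Y : Type*} [NormedAddCommGroup F] [NormedSpace ℝ F] [FiniteDimensional ℝ F]
  [TopologicalSpace Y]

/-- Positivity on the compact unit sphere of a maximal positive definite subspace persists under
small perturbation. -/
theorem eventually_sigPos_le (Q : Y → QuadraticForm ℝ F) (y₀ : Y)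
    (hQ : ∀ x, ContinuousAt (fun p : Y × F => Q p.1 p.2) (y₀, x)) :
    ∀ᶠ y in 𝓝 y₀, sigPos (Q y₀) ≤ sigPos (Q y) := by
  obtain ⟨V, hV, hpos⟩ := exists_finrank_eq_sigPos_and_posDef (Q y₀)
  have : ProperSpace F := FiniteDimensional.proper ℝ F
  have hK : IsCompact ((V : Set F) ∩ Metric.sphere 0 1) :=
    (isCompact_sphere 0 1).inter_left V.closed_of_finiteDimensional
  have hev : ∀ᶠ y in 𝓝 y₀, ∀ x ∈ (V : Set F) ∩ Metric.sphere 0 1, 0 < Q y x := by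
    refine hK.eventually_forall_of_forall_eventually fun x hx => ?_
    refine (hQ x).eventually (lt_mem_nhds ?_)
    refine hpos ⟨x, hx.1⟩ ?_
    intro h
    have : x = 0 := congrArg Subtype.val h
    simp [this] at hx
  filter_upwards [hev] with y hy
  rw [← hV]
  refine finrank_le_sigPos _ V.subtype fun x hx => ?_
  have hn : ‖(x : F)‖ ≠ 0 := by simpa using hx
  have h1 := hy (‖(x : F)‖⁻¹ • (x : F)) ⟨V.smul_mem _ x.2, by simp [norm_smul, hn]⟩
  rw [QuadraticMap.map_smul] at h1
  exact pos_of_mul_pos_right h1 (mul_self_nonneg _)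

/-- Both indices are lower semicontinuous, and at a nondegenerate form they already exhaust the
dimension, so neither can grow. -/
theorem eventually_qsign_eq (Q : Y → QuadraticForm ℝ F) (y₀ : Y)
    (hQ : ∀ x, ContinuousAt (fun p : Y × F => Q p.1 p.2) (y₀, x)) (h₀ : (Q y₀).radical = ⊥) :
    ∀ᶠ y in 𝓝 y₀, qsign (Q y) = qsign (Q y₀) ∧ (Q y).radical = ⊥ := by
  have h1 := eventually_sigPos_le Q y₀ hQ
  have h2 := eventually_sigPos_le (fun y => -Q y) y₀ fun x => (hQ x).neg
  filter_upwards [h1, h2] with y hy1 hy2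
  rw [sigPos_neg, sigPos_neg] at hy2
  have h3 := QuadraticForm.sigPos_add_sigNeg_add_radical (Q := Q y₀)
  have h4 := QuadraticForm.sigPos_add_sigNeg_add_radical (Q := Q y)
  rw [h₀, finrank_bot] at h3
  refine ⟨?_, Submodule.finrank_eq_zero.1 (by omega)⟩
  simp only [qsign]
  omega

end Signature

end

noncomputable section

/-! ### Common complements and the Kashiwara index. -/

section SymplecticAlgebra

open Module

variable {W : Type*} [AddCommGroup W] [Module ℝ W]

theorem SymplecticForm.neg_apply (ω : SymplecticForm W) (x y : W) : -ω.form x y = ω.form y x :=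
  ω.isAlt.neg_eq x y

theorem Lagrangian.finrank_eq {ω : SymplecticForm W} (L L' : Lagrangian ω) :
    finrank ℝ L.space = finrank ℝ L'.space := by
  have := L.two_mul_finrank
  have := L'.two_mul_finrank
  omega

section Complement

variable [FiniteDimensional ℝ W] {ω : SymplecticForm W}

theorem Lagrangian.orthogonal_eq (L : Lagrangian ω) : ω.form.orthogonal L.space = L.space := by
  symm
  refine Submodule.eq_of_le_of_finrank_eq (fun x hx y hy => L.isotropic y hy x hx) ?_
  rw [LinearMap.BilinForm.finrank_orthogonal ω.nondegenerate]
  have := L.two_mul_finrank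
  omega

theorem Lagrangian.isCompl_of_disjoint {L N : Lagrangian ω} (h : Disjoint L.space N.space) :
    IsCompl L.space N.space := by
  refine ⟨h, codisjoint_iff.2 (Submodule.eq_top_of_finrank_eq ?_)⟩
  have h1 := Submodule.finrank_sup_add_finrank_inf_eq L.space N.space
  rw [h.eq_bot, finrank_bot] at h1
  have := L.two_mul_finrank
  have := N.two_mul_finrank
  omega

/-- Otherwise the orthogonal of `S ⊔ L` lies in `S ⊓ L = ⊥`, so `S ⊔ L` is everything, which its
dimension forbids. -/
theorem Lagrangian.not_orthogonal_le_sup (L : Lagrangian ω) {S : Submodule ℝ W}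
    (hS : finrank ℝ S < finrank ℝ L.space) (hd : Disjoint S L.space) :
    ¬ ω.form.orthogonal S ≤ S ⊔ L.space := by
  intro h
  have h1 : ω.form.orthogonal (S ⊔ L.space) = ⊥ := by
    rw [eq_bot_iff, ← hd.eq_bot]
    refine le_inf ?_ ?_
    · refine (LinearMap.BilinForm.orthogonal_le h).trans ?_
      rw [LinearMap.BilinForm.orthogonal_orthogonal ω.nondegenerate ω.isAlt.isRefl]
    · refine (LinearMap.BilinForm.orthogonal_le le_sup_right).trans ?_
      rw [L.orthogonal_eq]
  have h2 := LinearMap.BilinForm.finrank_orthogonal ω.nondegenerate (S ⊔ L.space)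
  rw [h1, finrank_bot] at h2
  have h3 := Submodule.finrank_add_le_finrank_add_finrank S L.space
  have := L.two_mul_finrank
  omega

/-- Enlarge `S` by a vector orthogonal to it and outside every `S ⊔ L i`. One exists because a real
vector space is not a finite union of proper subspaces. -/
theorem exists_isotropic_disjoint {ι : Type*} [Finite ι] [Nonempty ι] (L : ι → Lagrangian ω)
    (k : ℕ) (hk : ∀ i, k ≤ finrank ℝ (L i).space) :
    ∃ S : Submodule ℝ W, finrank ℝ S = k ∧ (∀ x ∈ S, ∀ y ∈ S, ω.form x y = 0) ∧
      ∀ i, Disjoint S (L i).space := by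
  induction k with
  | zero => exact ⟨⊥, finrank_bot ℝ W, by simp, fun i => disjoint_bot_left⟩
  | succ k ih =>
    obtain ⟨S, hk', hiso, hd⟩ := ih fun i => (Nat.le_succ k).trans (hk i)
    obtain ⟨v, hv, hvL⟩ : ∃ v ∈ ω.form.orthogonal S, ∀ i, v ∉ S ⊔ (L i).space := by
      by_contra! hcon
      obtain ⟨i, hi⟩ := Subspace.exists_eq_top_of_iUnion_eq_univ
        (p := fun i => (S ⊔ (L i).space).comap (ω.form.orthogonal S).subtype) (by
          refine Set.eq_univ_of_forall fun x => ?_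
          obtain ⟨i, hi⟩ := hcon x x.2
          exact Set.mem_iUnion.2 ⟨i, hi⟩)
      refine (L i).not_orthogonal_le_sup (hk' ▸ hk i) (hd i) ?_
      exact Submodule.comap_subtype_eq_top.1 hi
    have hvS : v ∉ S := fun h => hvL (Classical.arbitrary ι) (Submodule.mem_sup_left h)
    refine ⟨S ⊔ Submodule.span ℝ {v}, ?_, ?_, fun i => ?_⟩
    · rw [Submodule.finrank_sup_span_singleton hvS, hk']
    · intro x hx y hy
      obtain ⟨s, hs, _, hc, rfl⟩ := Submodule.mem_sup.1 hx
      obtain ⟨c, rfl⟩ := Submodule.mem_span_singleton.1 hc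
      obtain ⟨s', hs', _, hc', rfl⟩ := Submodule.mem_sup.1 hy
      obtain ⟨c', rfl⟩ := Submodule.mem_span_singleton.1 hc'
      have h1 : ω.form s v = 0 := hv s hs
      have h2 : ω.form v s' = 0 := by rw [← ω.neg_apply, show ω.form s' v = 0 from hv s' hs', neg_zero]
      simp [hiso s hs s' hs', h1, h2, ω.isAlt.self_eq_zero]
    · rw [Submodule.disjoint_def]
      intro x hx hxL
      obtain ⟨s, hs, _, hc, rfl⟩ := Submodule.mem_sup.1 hx
      obtain ⟨c, rfl⟩ := Submodule.mem_span_singleton.1 hc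
      obtain rfl | hc0 := eq_or_ne c 0
      · simp only [zero_smul, add_zero] at hxL ⊢
        exact Submodule.disjoint_def.1 (hd i) s hs hxL
      · refine absurd ?_ (hvL i)
        have : c⁻¹ • ((s + c • v) - s) ∈ S ⊔ (L i).space :=
          Submodule.smul_mem _ _ (Submodule.sub_mem _ (Submodule.mem_sup_right hxL)
            (Submodule.mem_sup_left hs))
        rwa [add_sub_cancel_left, smul_smul, inv_mul_cancel₀ hc0, one_smul] at this

/-- Finitely many Lagrangian subspaces have a common Lagrangian complement. -/
theorem exists_forall_isCompl {ι : Type*} [Finite ι] [Nonempty ι] (L : ι → Lagrangian ω) :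
    ∃ N : Lagrangian ω, ∀ i, IsCompl (L i).space N.space := by
  obtain ⟨S, hS, hiso, hd⟩ := exists_isotropic_disjoint L
    (finrank ℝ (L (Classical.arbitrary ι)).space) fun i => ((L _).finrank_eq (L i)).le
  let N : Lagrangian ω := ⟨S, hS ▸ (L _).two_mul_finrank, hiso⟩
  exact ⟨N, fun i => Lagrangian.isCompl_of_disjoint (N := N) (hd i).symm⟩

end Complement

/-- The section of `W → W ⧸ N` with values in a complement `L` of `N`. -/
def complSection {N L : Submodule ℝ W} (h : IsCompl L N) : (W ⧸ N) ≃ₗ[ℝ] L :=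
  N.quotientEquivOfIsCompl L h.symm

theorem mk_complSection {N L : Submodule ℝ W} (h : IsCompl L N) (q : W ⧸ N) :
    (Submodule.Quotient.mk (complSection h q : W) : W ⧸ N) = q := by
  obtain ⟨x, rfl⟩ := (complSection h).symm.surjective q
  rw [LinearEquiv.apply_symm_apply]
  rfl

theorem complSection_sub_mem {N L L' : Submodule ℝ W} (h : IsCompl L N) (h' : IsCompl L' N)
    (q : W ⧸ N) : (complSection h q : W) - complSection h' q ∈ N := by
  rw [← Submodule.Quotient.eq, mk_complSection, mk_complSection]

variable {ω : SymplecticForm W} {N L₀ L₁ L₂ : Lagrangian ω}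

/-- Sections of `W ⧸ N` differ by elements of the isotropic `N`, so every pairing reduces to
pairings with one reference section. -/
theorem form_complSection (h₀ : IsCompl L₀.space N.space) (h₁ : IsCompl L₁.space N.space)
    (h₂ : IsCompl L₂.space N.space) (x y : W ⧸ N.space) :
    ω.form (complSection h₁ x) (complSection h₂ y) =
      ω.form (complSection h₁ x) (complSection h₀ y) -
        ω.form (complSection h₂ x) (complSection h₀ y) := by
  have e1 := N.isotropic _ (complSection_sub_mem h₁ h₀ x) _ (complSection_sub_mem h₂ h₀ y)
  have e2 := N.isotropic _ (complSection_sub_mem h₂ h₀ x) _ (complSection_sub_mem h₂ h₀ y)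
  have e3 := L₀.isotropic _ (complSection h₀ x).2 _ (complSection h₀ y).2
  have e4 := L₂.isotropic _ (complSection h₂ x).2 _ (complSection h₂ y).2
  simp only [map_sub, LinearMap.sub_apply] at e1 e2
  linarith

theorem form_complSection_antisymm (h₀ : IsCompl L₀.space N.space)
    (h₁ : IsCompl L₁.space N.space) (x y : W ⧸ N.space) :
    ω.form (complSection h₀ x) (complSection h₁ y) =
      -ω.form (complSection h₁ x) (complSection h₀ y) := by
  rw [form_complSection h₀ h₀ h₁, L₀.isotropic _ (complSection h₀ x).2 _ (complSection h₀ y).2,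
    zero_sub]

theorem form_complSection_symm (h₀ : IsCompl L₀.space N.space)
    (h₁ : IsCompl L₁.space N.space) (x y : W ⧸ N.space) :
    ω.form (complSection h₁ x) (complSection h₀ y) =
      ω.form (complSection h₁ y) (complSection h₀ x) := by
  rw [← ω.neg_apply, form_complSection_antisymm h₀ h₁, neg_neg]

/-- The form on `W ⧸ N` corresponding to the difference of the Lagrangians `L₁` and `L₀`, both
complementary to `N`. -/
def relForm (h₀ : IsCompl L₀.space N.space) (h₁ : IsCompl L₁.space N.space) :
    QuadraticForm ℝ (W ⧸ N.space) :=
  LinearMap.BilinMap.toQuadraticMap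
    (ω.form.compl₁₂ (L₁.space.subtype.comp (complSection h₁).toLinearMap)
      (L₀.space.subtype.comp (complSection h₀).toLinearMap))

theorem relForm_apply (h₀ : IsCompl L₀.space N.space) (h₁ : IsCompl L₁.space N.space)
    (x : W ⧸ N.space) :
    relForm h₀ h₁ x = ω.form (complSection h₁ x) (complSection h₀ x) := rfl

theorem graphMap_complSection (h₀ : IsCompl L₀.space N.space) (h₁ : IsCompl L₁.space N.space)
    (q : W ⧸ N.space) : (graphMap L₀.space N.space L₁.space h₁ (complSection h₀ q) : W) =
      complSection h₁ q - complSection h₀ q := by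
  have h1 := add_graphMap_mem L₀.space N.space L₁.space h₁ (complSection h₀ q)
  have h2 := L₁.space.sub_mem h1 (complSection h₁ q).2
  have h3 := N.space.sub_mem (graphMap L₀.space N.space L₁.space h₁ (complSection h₀ q)).2
    (complSection_sub_mem h₁ h₀ q)
  have h4 := Submodule.disjoint_def.1 h₁.disjoint _ (by convert h2 using 1; abel) h3
  exact sub_eq_zero.1 h4

open Classical in
/-- The signature of `φ_{L₀,N}(L)`, where it is defined. -/
def chartSign (N L₀ L : Lagrangian ω) : ℤ :=
  if h : IsCompl L.space N.space then bilinSign (chartForm ω L₀.space N.space L.space h) else 0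

theorem chartSign_of_isCompl (h : IsCompl L₁.space N.space) :
    chartSign N L₀ L₁ = bilinSign (chartForm ω L₀.space N.space L₁.space h) := dif_pos h

theorem chartSign_eq (h₀ : IsCompl L₀.space N.space) (h₁ : IsCompl L₁.space N.space) :
    chartSign N L₀ L₁ = qsign (relForm h₀ h₁) := by
  rw [chartSign_of_isCompl h₁]
  refine (qsign_congr (complSection h₀) fun q => ?_).symm
  rw [LinearMap.BilinMap.toQuadraticMap_apply, chartForm_apply, graphMap_complSection h₀ h₁,
    relForm_apply, map_sub, LinearMap.sub_apply,
    L₀.isotropic _ (complSection h₀ q).2 _ (complSection h₀ q).2, sub_zero]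

theorem chartSign_antisymm (h₀ : IsCompl L₀.space N.space) (h₁ : IsCompl L₁.space N.space) :
    chartSign N L₁ L₀ = -chartSign N L₀ L₁ := by
  rw [chartSign_eq h₀ h₁, chartSign_eq h₁ h₀, ← qsign_neg]
  congr 1
  ext x
  rw [neg_apply, relForm_apply, relForm_apply, form_complSection_antisymm]

/-- The Kashiwara index of a triple of Lagrangian subspaces. -/
def kashiwaraIndex (L₀ L₁ L₂ : Lagrangian ω) : ℤ :=
  let p₀ := L₀.space.subtype.comp (LinearMap.fst ℝ L₀.space (L₁.space × L₂.space))
  let p₁ := L₁.space.subtype.comp ((LinearMap.fst ℝ L₁.space L₂.space).comp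
    (LinearMap.snd ℝ L₀.space (L₁.space × L₂.space)))
  let p₂ := L₂.space.subtype.comp ((LinearMap.snd ℝ L₁.space L₂.space).comp
    (LinearMap.snd ℝ L₀.space (L₁.space × L₂.space)))
  qsign (LinearMap.BilinMap.toQuadraticMap
    (ω.form.compl₁₂ p₀ p₁ + ω.form.compl₁₂ p₁ p₂ + ω.form.compl₁₂ p₂ p₀))

theorem kashiwaraIndex_eq_qsign {E : Type*} [AddCommGroup E] [Module ℝ E] (Q : QuadraticForm ℝ E)
    (e : E ≃ₗ[ℝ] L₀.space × L₁.space × L₂.space)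
    (h : ∀ x, ω.form (e x).1 (e x).2.1 + ω.form (e x).2.1 (e x).2.2 + ω.form (e x).2.2 (e x).1
      = Q x) : kashiwaraIndex L₀ L₁ L₂ = qsign Q :=
  (qsign_congr e h).symm

/-- The automorphism `(u, v, w) ↦ (u + w, u + v, v + w)`. -/
def pairwiseSumEquiv (E : Type*) [AddCommGroup E] [Module ℝ E] : (E × E × E) ≃ₗ[ℝ] E × E × E where
  toFun p := (p.1 + p.2.2, p.1 + p.2.1, p.2.1 + p.2.2)
  invFun p := ((2⁻¹ : ℝ) • (p.1 + p.2.1 - p.2.2), (2⁻¹ : ℝ) • (p.2.1 + p.2.2 - p.1),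
    (2⁻¹ : ℝ) • (p.1 + p.2.2 - p.2.1))
  map_add' p q := by
    ext <;> simp only [Prod.fst_add, Prod.snd_add] <;> abel
  map_smul' c p := by simp
  left_inv p := by
    ext <;> simp only <;> module
  right_inv p := by
    ext <;> simp only <;> module

/-- Once all three Lagrangians are identified with `W ⧸ N`, the substitution by pairwise sums
diagonalizes the Kashiwara form: the cross terms cancel by symmetry of the relative forms. -/
theorem kashiwaraIndex_eq_chartSign [FiniteDimensional ℝ W] (h₀ : IsCompl L₀.space N.space)
    (h₁ : IsCompl L₁.space N.space) (h₂ : IsCompl L₂.space N.space) :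
    kashiwaraIndex L₀ L₁ L₂ = -(chartSign N L₀ L₁ + chartSign N L₁ L₂ + chartSign N L₂ L₀) := by
  rw [chartSign_eq h₀ h₁, chartSign_eq h₁ h₂, chartSign_eq h₂ h₀, add_assoc, ← qsign_prod,
    ← qsign_prod, ← qsign_neg]
  refine kashiwaraIndex_eq_qsign _ ((pairwiseSumEquiv (W ⧸ N.space)).trans
    ((complSection h₀).prodCongr ((complSection h₁).prodCongr (complSection h₂)))) ?_
  rintro ⟨u, v, w⟩
  change ω.form (complSection h₀ (u + w)) (complSection h₁ (u + v)) +
    ω.form (complSection h₁ (u + v)) (complSection h₂ (v + w)) +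
    ω.form (complSection h₂ (v + w)) (complSection h₀ (u + w)) =
      -(relForm h₀ h₁ u + (relForm h₁ h₂ v + relForm h₂ h₀ w))
  simp only [relForm_apply]
  rw [form_complSection h₀ h₁ h₂, form_complSection_antisymm h₀ h₁,
    form_complSection h₀ h₂ h₁, form_complSection_antisymm h₀ h₂]
  simp only [map_add, Submodule.coe_add, LinearMap.add_apply]
  linarith [form_complSection_symm h₀ h₁ u v, form_complSection_symm h₀ h₁ u w,
    form_complSection_symm h₀ h₁ v w, form_complSection_symm h₀ h₂ u v,
    form_complSection_symm h₀ h₂ u w, form_complSection_symm h₀ h₂ v w]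

/-- If `L₀` and `L₂` are both complementary to `N`, the Kashiwara index of `(L₀, N, L₂)` is the
signature of the form describing `L₂` in the chart `(L₀, N)`. -/
theorem kashiwaraIndex_of_isCompl [FiniteDimensional ℝ W] (h₀ : IsCompl L₀.space N.space)
    (h₂ : IsCompl L₂.space N.space) : kashiwaraIndex L₀ N L₂ = chartSign N L₀ L₂ := by
  let H : QuadraticForm ℝ ((W ⧸ N.space) × N.space) :=
    LinearMap.BilinMap.toQuadraticMap (ω.form.compl₁₂
      (L₀.space.subtype.comp ((complSection h₀).toLinearMap.comp (LinearMap.fst ℝ _ N.space)))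
      (N.space.subtype.comp (LinearMap.snd ℝ (W ⧸ N.space) _)))
  have hH : ∀ x m, H (x, m) = ω.form (complSection h₀ x) m := fun x m => rfl
  -- `H` is a pairing of two factors, so changing the sign of one factor negates it.
  have hH0 : qsign H = 0 := by
    refine qsign_eq_zero_of_neg H ((LinearEquiv.neg ℝ).prodCongr (LinearEquiv.refl ℝ _)) ?_
    rintro ⟨x, m⟩
    change H (-x, m) = -H (x, m)
    simp [hH]
  have key : kashiwaraIndex L₀ N L₂ = qsign (H.prod (relForm h₀ h₂)) := by
    -- Shifting the `N`-component by `d` completes the square: the form splits into the pairing `H`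
    -- and the relative form.
    let d : (W ⧸ N.space) →ₗ[ℝ] N.space := LinearMap.codRestrict N.space
      (L₂.space.subtype.comp (complSection h₂).toLinearMap -
        L₀.space.subtype.comp (complSection h₀).toLinearMap) (complSection_sub_mem h₂ h₀)
    have hd : ∀ x, (d x : W) = complSection h₂ x - complSection h₀ x := fun x => rfl
    let e : (((W ⧸ N.space) × N.space) × (W ⧸ N.space)) ≃ₗ[ℝ]
        L₀.space × N.space × L₂.space :=
      { toFun := fun p => (complSection h₀ (p.1.1 + p.2), p.1.2 + d p.2, complSection h₂ p.2)
        invFun := fun p => (((complSection h₀).symm p.1 - (complSection h₂).symm p.2.2,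
          p.2.1 - d ((complSection h₂).symm p.2.2)), (complSection h₂).symm p.2.2)
        map_add' := fun p q => by
          refine Prod.ext ?_ (Prod.ext ?_ ?_) <;>
            simp only [Prod.fst_add, Prod.snd_add, map_add] <;> abel
        map_smul' := fun c p => by simp
        left_inv := fun p => by simp
        right_inv := fun p => by simp }
    refine kashiwaraIndex_eq_qsign _ e ?_
    rintro ⟨⟨y, m⟩, r⟩
    change ω.form (complSection h₀ (y + r)) (m + d r : N.space) +
      ω.form (m + d r : N.space) (complSection h₂ r) +
      ω.form (complSection h₂ r) (complSection h₀ (y + r)) = H (y, m) + relForm h₀ h₂ r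
    have e1 := N.isotropic m m.2 _ (d r).2
    have e2 := form_complSection_antisymm h₀ h₂ y r
    have e3 := form_complSection_symm h₀ h₂ y r
    have e4 := form_complSection_antisymm h₀ h₂ r r
    have e5 := L₀.isotropic _ (complSection h₀ y).2 _ (complSection h₀ r).2
    have e6 := L₀.isotropic _ (complSection h₀ r).2 _ (complSection h₀ r).2
    have e7 := L₂.isotropic _ (complSection h₂ r).2 _ (complSection h₂ r).2
    have e8 := ω.neg_apply m (complSection h₀ r)
    rw [hd] at e1
    simp only [hH, relForm_apply, map_add, Submodule.coe_add, LinearMap.add_apply, hd, map_sub,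
      LinearMap.sub_apply] at e1 ⊢
    linarith
  rw [key, qsign_prod, hH0, zero_add, chartSign_eq h₀ h₂]

end SymplecticAlgebra

end

noncomputable section

/-! ### Topology of the Lagrangian Grassmannian and the symplectic action. -/

section LagrangianTopology

open Module Topology

variable {W : Type*} [NormedAddCommGroup W] [NormedSpace ℝ W]

theorem isOpen_grassmann_iff {O : Set (Submodule ℝ W)} :
    IsOpen[grassmannTopology W] O ↔ ∀ k, IsOpen {f : {f : Fin k → W // LinearIndependent ℝ f} |
      Submodule.span ℝ (Set.range f.1) ∈ O} := by
  rw [isOpen_coinduced, isOpen_sigma_iff]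
  rfl

theorem Lagrangian.isOpen_preimage {ω : SymplecticForm W} {O : Set (Submodule ℝ W)}
    (h : IsOpen[grassmannTopology W] O) : IsOpen {L : Lagrangian ω | L.space ∈ O} :=
  (@isOpen_induced_iff _ _ (grassmannTopology W) _ _).2 ⟨O, h, rfl⟩

theorem continuous_lagrangian_of_frame {ω : SymplecticForm W} {Y E : Type*} [TopologicalSpace Y]
    [AddCommGroup E] [Module ℝ E] {k : ℕ} (b : Basis (Fin k) ℝ E) (g : Y → Lagrangian ω)
    (F : Y → E →ₗ[ℝ] W) (hinj : ∀ y, Function.Injective (F y))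
    (hrange : ∀ y, (g y).space = LinearMap.range (F y))
    (hF : ∀ x, Continuous fun y => F y x) : Continuous g := by
  refine continuous_induced_rng.2 ?_
  have hli : ∀ y, LinearIndependent ℝ (F y ∘ b) := fun y =>
    b.linearIndependent.map' _ (LinearMap.ker_eq_bot.2 (hinj y))
  let G : Y → Σ k : ℕ, {f : Fin k → W // LinearIndependent ℝ f} := fun y => ⟨_, _, hli y⟩
  have hG : Continuous G :=
    continuous_sigmaMk.comp (Continuous.subtype_mk (continuous_pi fun i => hF (b i)) _)
  have hcomp : Lagrangian.space ∘ g =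
      (fun f : Σ k : ℕ, {f : Fin k → W // LinearIndependent ℝ f} =>
        Submodule.span ℝ (Set.range f.2.1)) ∘ G := by
    funext y
    simp only [Function.comp_apply, G]
    rw [hrange, Set.range_comp, ← Submodule.map_span, b.span_eq, LinearMap.range_eq_map]
  rw [hcomp]
  let _ := grassmannTopology W
  exact continuous_coinduced_rng.comp hG

variable {ω : SymplecticForm W}

/-- The restriction of a quadratic form to a subspace, pulled back along a frame. -/
def frameForm (Q : QuadraticForm ℝ W) {k : ℕ} (f : Fin k → W) : QuadraticForm ℝ (Fin k → ℝ) :=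
  Q.comp (Fintype.linearCombination ℝ f)

/-- The quadratic form `Q` is equivalent on the span of a frame to its pullback along the frame. -/
theorem frameForm_equivalent (Q : QuadraticForm ℝ W) {k : ℕ} {f : Fin k → W}
    (hf : LinearIndependent ℝ f) :
    (frameForm Q f).Equivalent (Q.restrict (Submodule.span ℝ (Set.range f))) := by
  refine ⟨{ (Basis.span hf).equivFun.symm with map_app' := fun a => ?_ }⟩
  change Q ((Basis.span hf).equivFun.symm a : W) = Q (Fintype.linearCombination ℝ f a)
  simp [Basis.equivFun_symm_apply, Basis.span_apply, Fintype.linearCombination_apply]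

variable {N M L : Lagrangian ω}

/-- The quadratic form on `W` whose restriction to each complement of `N` represents
its difference from `M`. -/
def ambientForm (hM : IsCompl M.space N.space) : QuadraticForm ℝ W :=
  LinearMap.BilinMap.toQuadraticMap (ω.form.compl₁₂ LinearMap.id
    (M.space.subtype.comp ((complSection hM).toLinearMap.comp N.space.mkQ)))

theorem ambientForm_complSection (hM : IsCompl M.space N.space) (hL : IsCompl L.space N.space)
    (q : W ⧸ N.space) : ambientForm hM (complSection hL q) = relForm hM hL q := by
  change ω.form _ (complSection hM (Submodule.Quotient.mk (complSection hL q : W)) : W) = _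
  rw [mk_complSection]
  rfl

/-- This moves the dependence on `L` from the form to the subspace: one fixed form on `W` is
restricted to varying `L`. -/
theorem chartSign_eq_ambientForm (hM : IsCompl M.space N.space) (hL : IsCompl L.space N.space) :
    chartSign N M L = qsign ((ambientForm hM).restrict L.space) := by
  rw [chartSign_eq hM hL]
  exact qsign_congr (complSection hL) (ambientForm_complSection hM hL)

namespace Lagrangian

/-- The image of a Lagrangian subspace under a symplectic automorphism. -/
def map (g : W ≃ₗ[ℝ] W) (hg : ∀ x y, ω.form (g x) (g y) = ω.form x y) (L : Lagrangian ω) :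
    Lagrangian ω where
  space := L.space.map (g : W →ₗ[ℝ] W)
  two_mul_finrank := by rw [LinearEquiv.finrank_map_eq, L.two_mul_finrank]
  isotropic := by
    rintro _ ⟨x, hx, rfl⟩ _ ⟨y, hy, rfl⟩
    exact (hg x y).trans (L.isotropic x hx y hy)

variable {g : W ≃ₗ[ℝ] W} (hg : ∀ x y, ω.form (g x) (g y) = ω.form x y)

theorem isCompl_map (h : IsCompl L.space N.space) :
    IsCompl (L.map g hg).space (N.map g hg).space :=
  (Submodule.orderIsoMapComap g).isCompl h

theorem kashiwaraIndex_map : kashiwaraIndex (L.map g hg) (M.map g hg) (N.map g hg) =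
    kashiwaraIndex L M N := by
  refine kashiwaraIndex_eq_qsign _ ((g.submoduleMap L.space).prodCongr
    ((g.submoduleMap M.space).prodCongr (g.submoduleMap N.space))) ?_
  rintro ⟨x, y, z⟩
  change ω.form (g x) (g y) + ω.form (g y) (g z) + ω.form (g z) (g x) =
    ω.form x y + ω.form y z + ω.form z x
  rw [hg, hg, hg]

/-- The Kashiwara index is built from `ω` alone, so its invariance is direct and passes to the chart
signature. -/
theorem chartSign_map [FiniteDimensional ℝ W] (hM : IsCompl M.space N.space)
    (hL : IsCompl L.space N.space) :
    chartSign (N.map g hg) (M.map g hg) (L.map g hg) = chartSign N M L := by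
  rw [← kashiwaraIndex_of_isCompl hM hL, ← kashiwaraIndex_of_isCompl (isCompl_map hg hM)
    (isCompl_map hg hL), kashiwaraIndex_map]

theorem continuous_map [FiniteDimensional ℝ W] :
    Continuous (Lagrangian.map (ω := ω) g hg) := by
  have hmap : Continuous[grassmannTopology W, grassmannTopology W]
      fun S : Submodule ℝ W => S.map (g : W →ₗ[ℝ] W) := by
    rw [continuous_coinduced_dom]
    let F : (Σ k : ℕ, {f : Fin k → W // LinearIndependent ℝ f}) →
        Σ k : ℕ, {f : Fin k → W // LinearIndependent ℝ f} := fun f =>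
      ⟨f.1, fun i => g (f.2.1 i), f.2.2.map' (g : W →ₗ[ℝ] W) g.ker⟩
    have hF : Continuous F := by
      refine continuous_sigma fun k => continuous_sigmaMk.comp
        (continuous_induced_rng.2 (continuous_pi fun i => ?_))
      exact (LinearMap.continuous_of_finiteDimensional (g : W →ₗ[ℝ] W)).comp
        ((continuous_apply i).comp continuous_subtype_val)
    have hcomp : ((fun S : Submodule ℝ W => S.map (g : W →ₗ[ℝ] W)) ∘
        fun f : Σ k : ℕ, {f : Fin k → W // LinearIndependent ℝ f} =>
          Submodule.span ℝ (Set.range f.2.1)) =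
        (fun f : Σ k : ℕ, {f : Fin k → W // LinearIndependent ℝ f} =>
          Submodule.span ℝ (Set.range f.2.1)) ∘ F := by
      funext f
      simp only [Function.comp_apply, F, Submodule.map_span, ← Set.range_comp]
      rfl
    rw [hcomp]
    let _ := grassmannTopology W
    exact continuous_coinduced_rng.comp hF
  let _ := grassmannTopology W
  exact continuous_induced_rng.2 (hmap.comp continuous_induced_dom)

end Lagrangian

variable [FiniteDimensional ℝ W]

/-- In the complementary dimension, a frame spans a complement exactly when it is independent of a
fixed basis of `N`, an open condition; in other dimensions there are no complements. -/
theorem isOpen_setOf_isCompl_grassmann (N : Submodule ℝ W) :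
    IsOpen[grassmannTopology W] {S | IsCompl S N} := by
  rw [isOpen_grassmann_iff]
  intro k
  let b := finBasis ℝ N
  have hb : LinearIndependent ℝ (N.subtype ∘ b) :=
    b.linearIndependent.map' _ N.ker_subtype
  have hspan : Submodule.span ℝ (Set.range (N.subtype ∘ b)) = N := by
    rw [Set.range_comp, ← Submodule.map_span, b.span_eq, Submodule.map_top, Submodule.range_subtype]
  by_cases hk : k + finrank ℝ N = finrank ℝ W
  · have : {f : {f : Fin k → W // LinearIndependent ℝ f} |
        Submodule.span ℝ (Set.range f.1) ∈ {S | IsCompl S N}} =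
        (fun f : {f : Fin k → W // LinearIndependent ℝ f} => Sum.elim f.1 (N.subtype ∘ b)) ⁻¹'
          {g | LinearIndependent ℝ g} := by
      ext f
      simp only [Set.mem_ofPred_eq, Set.mem_preimage, linearIndependent_sum, Sum.elim_comp_inl,
        Sum.elim_comp_inr, hspan, hb, f.2, true_and]
      refine ⟨fun h => h.disjoint, fun h => ⟨h, codisjoint_iff.2 ?_⟩⟩
      refine Submodule.eq_top_of_finrank_eq ?_
      have h1 := Submodule.finrank_sup_add_finrank_inf_eq (Submodule.span ℝ (Set.range f.1)) N
      rw [h.eq_bot, finrank_bot, finrank_span_eq_card f.2, Fintype.card_fin] at h1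
      omega
    rw [this]
    refine isOpen_setOfPred_linearIndependent.preimage (continuous_pi ?_)
    rintro (i | i)
    · exact (continuous_apply i).comp continuous_subtype_val
    · exact continuous_const
  · convert isOpen_empty
    rw [Set.eq_empty_iff_forall_notMem]
    intro f hf
    have h1 := Submodule.finrank_add_eq_of_isCompl hf
    rw [finrank_span_eq_card f.2, Fintype.card_fin] at h1
    exact hk h1

theorem Lagrangian.isOpen_setOf_isCompl (N : Submodule ℝ W) :
    IsOpen {L : Lagrangian ω | IsCompl L.space N} :=
  Lagrangian.isOpen_preimage (isOpen_setOf_isCompl_grassmann N)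

theorem continuous_quadraticForm (Q : QuadraticForm ℝ W) : Continuous Q := by
  have h : Continuous fun x : W => (QuadraticMap.associated (R := ℝ) Q).toContinuousBilinearMap x x :=
    (ContinuousLinearMap.continuous _).clm_apply continuous_id
  convert h using 2 with x
  rw [LinearMap.toContinuousBilinearMap_apply, QuadraticMap.associated_eq_self_apply]

/-- Frames pull the restrictions back to one space `Fin k → ℝ`, where the forms vary continuously
and nondegenerate signatures are locally constant. -/
theorem isOpen_setOf_qsign_restrict (Q : QuadraticForm ℝ W) (c : ℤ) :
    IsOpen[grassmannTopology W]
      {S | qsign (Q.restrict S) = c ∧ (Q.restrict S).radical = ⊥} := by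
  rw [isOpen_grassmann_iff]
  intro k
  have key : ∀ f : {f : Fin k → W // LinearIndependent ℝ f},
      (Submodule.span ℝ (Set.range f.1) ∈
        {S | qsign (Q.restrict S) = c ∧ (Q.restrict S).radical = ⊥}) ↔
      qsign (frameForm Q f.1) = c ∧ (frameForm Q f.1).radical = ⊥ := by
    intro f
    have he := frameForm_equivalent Q f.2
    simp only [Set.mem_ofPred_eq]
    rw [qsign, qsign, he.sigPos_eq, he.sigNeg_eq, ← Submodule.finrank_eq_zero,
      ← Submodule.finrank_eq_zero, he.rank_radical_eq]
  simp only [key]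
  rw [isOpen_iff_eventually]
  rintro f ⟨hc, hr⟩
  have hcont : Continuous fun p : {f : Fin k → W // LinearIndependent ℝ f} × (Fin k → ℝ) =>
      frameForm Q p.1.1 p.2 := by
    refine (continuous_quadraticForm Q).comp ?_
    simp only [Fintype.linearCombination_apply]
    refine continuous_finsetSum _ fun i _ => ?_
    refine Continuous.smul ?_ ?_
    · exact (continuous_apply i).comp continuous_snd
    · exact (continuous_apply i).comp (continuous_subtype_val.comp continuous_fst)
  have h := eventually_qsign_eq (fun f : {f : Fin k → W // LinearIndependent ℝ f} =>
    frameForm Q f.1) f (fun x => hcont.continuousAt) hr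
  rw [hc] at h
  exact h

/-- A radical vector gives an element of `L` orthogonal to `M`, hence in `L ⊓ M`. -/
theorem relForm_radical (hM : IsCompl M.space N.space) (hL : IsCompl L.space N.space)
    (hLM : IsCompl L.space M.space) : (relForm hM hL).radical = ⊥ := by
  rw [eq_bot_iff]
  intro q hq
  rw [QuadraticMap.mem_radical_iff'] at hq
  have h1 : ∀ r, ω.form (complSection hL q) (complSection hM r) = 0 := by
    intro r
    have h := hq.2 r
    have h0 := hq.1
    have hs := form_complSection_symm hM hL q r
    simp only [relForm_apply, map_add, Submodule.coe_add, LinearMap.add_apply] at h h0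
    linarith
  have h2 : (complSection hL q : W) ∈ M.space := by
    rw [← M.orthogonal_eq]
    intro m hm
    obtain ⟨r, hr⟩ := (complSection hM).surjective ⟨m, hm⟩
    have := h1 r
    rw [hr] at this
    change ω.form m _ = 0
    rw [← ω.neg_apply, this, neg_zero]
  have h3 := Submodule.disjoint_def.1 hLM.disjoint _ (complSection hL q).2 h2
  have h4 : complSection hL q = 0 := Subtype.ext h3
  simpa using h4

theorem ambientForm_restrict_radical (hM : IsCompl M.space N.space) (hL : IsCompl L.space N.space)
    (hLM : IsCompl L.space M.space) : ((ambientForm hM).restrict L.space).radical = ⊥ := by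
  have he : (relForm hM hL).Equivalent ((ambientForm hM).restrict L.space) :=
    ⟨{ complSection hL with map_app' := ambientForm_complSection hM hL }⟩
  rw [← Submodule.finrank_eq_zero, ← he.rank_radical_eq, relForm_radical hM hL hLM, finrank_bot]

/-- Away from the Lagrangians meeting `M`, the signature in the chart `(M, N)` is locally constant. -/
theorem eventually_chartSign_eq (hM : IsCompl M.space N.space) (hL : IsCompl L.space N.space)
    (hLM : IsCompl L.space M.space) : ∀ᶠ L' in 𝓝 L, chartSign N M L' = chartSign N M L := by
  have h1 := Lagrangian.isOpen_preimage (ω := ω)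
    (isOpen_setOf_qsign_restrict (ambientForm hM) (chartSign N M L))
  have h2 := h1.mem_nhds (x := L)
    ⟨(chartSign_eq_ambientForm hM hL).symm, ambientForm_restrict_radical hM hL hLM⟩
  filter_upwards [h2, (Lagrangian.isOpen_setOf_isCompl N.space).mem_nhds hL] with L' h3 h4
  rw [chartSign_eq_ambientForm hM h4]
  exact h3.1

/-- Lagrangians with a common Lagrangian complement are joined by a path. -/
theorem nonempty_path_of_isCompl {L' : Lagrangian ω} (h : IsCompl L.space N.space)
    (h' : IsCompl L'.space N.space) : Nonempty (Path L L') := by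
  let T := graphMap L.space N.space L'.space h'
  -- Scaling the graph map by `t` moves from `L` to `L'`; the graphs stay isotropic because the
  -- mixed terms of `ω` are linear in `t` and vanish at `t = 1`.
  let F : ℝ → L.space →ₗ[ℝ] W := fun t => L.space.subtype + t • N.space.subtype.comp T
  have hF : ∀ t u, F t u = u + t • (T u : W) := fun t u => rfl
  have hinj : ∀ t, Function.Injective (F t) := by
    intro t
    rw [injective_iff_map_eq_zero]
    intro u hu
    rw [hF] at hu
    have hu' : (u : W) ∈ N.space := by
      rw [eq_neg_of_add_eq_zero_left hu]
      exact N.space.neg_mem (N.space.smul_mem _ (T u).2)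
    exact Subtype.ext (Submodule.disjoint_def.1 h.disjoint _ u.2 hu')
  let g : ℝ → Lagrangian ω := fun t =>
    { space := LinearMap.range (F t)
      two_mul_finrank := by
        rw [LinearMap.finrank_range_of_inj (hinj t)]
        exact L.two_mul_finrank
      isotropic := by
        rintro _ ⟨u, rfl⟩ _ ⟨v, rfl⟩
        have e1 := L.isotropic u u.2 v v.2
        have e2 := N.isotropic _ (T u).2 _ (T v).2
        have e3 := L'.isotropic _ (add_graphMap_mem L.space N.space L'.space h' u) _
          (add_graphMap_mem L.space N.space L'.space h' v)
        change ω.form (u + (T u : W)) (v + (T v : W)) = 0 at e3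
        simp only [hF, map_add, map_smul, LinearMap.add_apply, LinearMap.smul_apply, e1, e2,
          smul_eq_mul] at e3 ⊢
        linear_combination t * e3 }
  have hg : Continuous g := continuous_lagrangian_of_frame (finBasis ℝ L.space) g F hinj
    (fun _ => rfl) fun u => by
      simp only [hF]
      fun_prop
  refine ⟨⟨⟨fun t : I => g t, hg.comp continuous_subtype_val⟩, ?_, ?_⟩⟩
  · refine Lagrangian.ext ?_
    change LinearMap.range (F ((0 : I) : ℝ)) = L.space
    ext x
    simp [hF]
  · refine Lagrangian.ext ?_
    change LinearMap.range (F ((1 : I) : ℝ)) = L'.space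
    ext x
    rw [mem_iff_exists_graphMap L.space N.space L'.space h h', LinearMap.mem_range]
    simp only [hF, Set.Icc.coe_one, one_smul, T]

theorem Lagrangian.nonempty_path (L L' : Lagrangian ω) : Nonempty (Path L L') := by
  obtain ⟨N, hN⟩ := exists_forall_isCompl ![L, L']
  exact nonempty_path_of_isCompl (hN 0) (hN 1)

end LagrangianTopology

end

noncomputable section

/-! ### Additivity of increments and change of coefficients. -/

namespace LocalPrimitives

variable {X ι A : Type*} [TopologicalSpace X] [AddCommGroup A] {P : LocalPrimitives X ι A}

theorem IsPrimitiveAlong.sub_eq_of_trans {a b c : X} {γ : Path a b} {δ : Path b c} {F G H : I → A}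
    (hF : P.IsPrimitiveAlong (γ.trans δ) F) (hG : P.IsPrimitiveAlong γ G)
    (hH : P.IsPrimitiveAlong δ H) : F 1 - F 0 = (G 1 - G 0) + (H 1 - H 0) := by
  let k₁ : I → I := fun t => ⟨t / 2, by have := t.2.1; have := t.2.2; constructor <;> linarith⟩
  let k₂ : I → I := fun t => ⟨(t + 1) / 2, by have := t.2.1; have := t.2.2; constructor <;> linarith⟩
  have hk₁ : Continuous k₁ := Continuous.subtype_mk (by fun_prop) _
  have hk₂ : Continuous k₂ := Continuous.subtype_mk (by fun_prop) _
  have h1 : γ.trans δ ∘ k₁ = γ := by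
    funext t
    have ht : (k₁ t : ℝ) ≤ 1 / 2 := by have := t.2.2; simp only [k₁]; linarith
    rw [Function.comp_apply, Path.trans_apply, dif_pos ht]
    congr 1
    ext
    simp only [k₁]
    ring
  have h2 : γ.trans δ ∘ k₂ = δ := by
    funext t
    rw [Function.comp_apply, Path.trans_apply]
    split_ifs with ht
    -- The midpoint belongs to the first branch of `Path.trans`; there the two paths agree.
    · have h0 : t = 0 := by
        have h3 : ((t : ℝ) + 1) / 2 ≤ 1 / 2 := ht
        exact Subtype.ext (le_antisymm (by simpa using (by linarith : (t : ℝ) ≤ 0)) t.2.1)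
      subst h0
      rw [δ.source]
      convert γ.target
      simp [k₂]
    · congr 1
      ext
      simp only [k₂]
      ring
  have e1 := hF.comp hk₁
  have e2 := hF.comp hk₂
  rw [h1] at e1
  rw [h2] at e2
  have e3 := hG.sub_eq γ.continuous e1 0 1
  have e4 := hH.sub_eq δ.continuous e2 0 1
  have e5 : k₁ 1 = k₂ 0 := by ext; simp [k₁, k₂]
  have e6 : k₁ 0 = 0 := by ext; simp [k₁]
  have e7 : k₂ 1 = 1 := by ext; simp [k₂]
  rw [e3, e4, Function.comp_apply, Function.comp_apply, Function.comp_apply, Function.comp_apply,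
    e5, e6, e7]
  abel

/-- Post-composition of the local functions with a homomorphism. -/
def map {B : Type*} [AddCommGroup B] (P : LocalPrimitives X ι A) (f : A →+ B) :
    LocalPrimitives X ι B where
  dom := P.dom
  isOpen_dom := P.isOpen_dom
  cover := P.cover
  val i x := f (P.val i x)
  overlap i j x hx := by
    filter_upwards [P.overlap i j x hx] with y hy
    rw [← map_sub, ← map_sub, hy]

theorem IsPrimitiveAlong.map {B Y : Type*} [AddCommGroup B] [TopologicalSpace Y] (f : A →+ B)
    {g : Y → X} {F : Y → A} (hF : P.IsPrimitiveAlong g F) :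
    (P.map f).IsPrimitiveAlong g (f ∘ F) := fun y => by
  obtain ⟨i, hi, h⟩ := hF y
  refine ⟨i, hi, h.mono fun z hz => ?_⟩
  change f (F z) - f (P.val i (g z)) = f (F y) - f (P.val i (g y))
  rw [← map_sub, ← map_sub, hz]

end LocalPrimitives

/-! ### The Maslov and Hörmander indices. -/

section MaslovIndex

open Topology LocalPrimitives

theorem maslovIndex_eq_of_homotopic {W : Type*} [NormedAddCommGroup W] [NormedSpace ℝ W]
    {ω : SymplecticForm W} (L₀ : Lagrangian ω) {A B : Lagrangian ω} {γ δ : Path A B}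
    (h : γ.Homotopic δ) :
    maslovIndex ω L₀ γ = maslovIndex ω L₀ δ := by
  rw [maslovIndex, maslovIndex, Path.Homotopic.Quotient.eq.2 h]

variable {W : Type*} [NormedAddCommGroup W] [NormedSpace ℝ W] [FiniteDimensional ℝ W]
  {ω : SymplecticForm W}

/-- The signatures in the charts `φ_{L₀,N}`. -/
def chartSignPrimitives (L₀ : Lagrangian ω) :
    LocalPrimitives (Lagrangian ω) {N : Lagrangian ω // IsCompl L₀.space N.space} ℤ where
  dom N := {L | IsCompl L.space N.1.space}
  isOpen_dom N := Lagrangian.isOpen_setOf_isCompl N.1.space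
  cover L := by
    obtain ⟨N, hN⟩ := exists_forall_isCompl ![L₀, L]
    exact ⟨⟨N, hN 0⟩, hN 1⟩
  val N L := chartSign N.1 L₀ L
  overlap := by
    rintro ⟨M, hM⟩ ⟨M', hM'⟩ L ⟨hL, hL'⟩
    obtain ⟨N, hN⟩ := exists_forall_isCompl ![L₀, M, M', L]
    have h₀ : IsCompl L₀.space N.space := hN 0
    have h₁ : IsCompl M.space N.space := hN 1
    have h₂ : IsCompl M'.space N.space := hN 2
    have h₃ : IsCompl L.space N.space := hN 3
    -- Each difference is computed from Kashiwara indices expanded along `N`; the terms pairing `L'`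
    -- with `L₀` cancel.
    have key : ∀ L' : Lagrangian ω, IsCompl L'.space N.space → IsCompl L'.space M.space →
        IsCompl L'.space M'.space → chartSign M L₀ L' - chartSign M' L₀ L' =
          (chartSign N L₀ M' - chartSign N L₀ M) + (chartSign N M' L' - chartSign N M L') := by
      intro L' k₁ k₂ k₃
      rw [← kashiwaraIndex_of_isCompl hM k₂, ← kashiwaraIndex_of_isCompl hM' k₃,
        kashiwaraIndex_eq_chartSign h₀ h₁ k₁, kashiwaraIndex_eq_chartSign h₀ h₂ k₁]
      ring
    filter_upwards [(Lagrangian.isOpen_setOf_isCompl N.space).mem_nhds h₃,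
      (Lagrangian.isOpen_setOf_isCompl M.space).mem_nhds hL,
      (Lagrangian.isOpen_setOf_isCompl M'.space).mem_nhds hL',
      eventually_chartSign_eq h₁ h₃ hL, eventually_chartSign_eq h₂ h₃ hL'] with L' k₁ k₂ k₃ k₄ k₅
    rw [key L' k₁ k₂ k₃, key L h₃ hL hL', k₄, k₅]

/-- The homomorphism `k ↦ k / 2` from `ℤ` to `ℚ`. -/
def halfHom : ℤ →+ ℚ := (AddMonoidHom.mulRight (2⁻¹ : ℚ)).comp (Int.castAddHom ℚ)

theorem halfHom_apply (k : ℤ) : halfHom k = (k : ℚ) / 2 := (div_eq_mul_inv _ _).symm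

/-- The half-signatures in the charts `φ_{L₀,N}`, the local values of the Maslov index. -/
def maslovPrimitives (L₀ : Lagrangian ω) :
    LocalPrimitives (Lagrangian ω) {N : Lagrangian ω // IsCompl L₀.space N.space} ℚ :=
  (chartSignPrimitives L₀).map halfHom

theorem maslovPrimitives_val (L₀ : Lagrangian ω) (N : {N : Lagrangian ω // IsCompl L₀.space N.space})
    (L : Lagrangian ω) : (maslovPrimitives L₀).val N L = (chartSign N.1 L₀ L : ℚ) / 2 :=
  halfHom_apply _

theorem exists_isPrimitiveAlong (L₀ : Lagrangian ω) {A B : Lagrangian ω} (γ : Path A B) :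
    ∃ F, (maslovPrimitives L₀).IsPrimitiveAlong γ F := by
  obtain ⟨m, hm⟩ := (chartSignPrimitives L₀).exists_map_quotient_isPrimitiveAlong
  obtain ⟨F, hF, -⟩ := hm _ _ γ
  exact ⟨_, hF.map halfHom⟩

theorem IsMaslovIndex.eq_val_sub_val {L₀ : Lagrangian ω}
    {μ : ∀ A B : Lagrangian ω, Path.Homotopic.Quotient A B → ℚ} (hμ : IsMaslovIndex ω L₀ μ)
    (A B : Lagrangian ω) (γ : Path A B) (N : {N : Lagrangian ω // IsCompl L₀.space N.space})
    (h : ∀ t, γ t ∈ (maslovPrimitives L₀).dom N) :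
    μ A B (Path.Homotopic.Quotient.mk γ) =
      (maslovPrimitives L₀).val N B - (maslovPrimitives L₀).val N A := by
  rw [hμ.chart N.1 N.2 A B γ h, maslovPrimitives_val, maslovPrimitives_val,
    ← chartSign_of_isCompl (h 1), ← chartSign_of_isCompl (h 0), γ.source, γ.target]

theorem IsMaslovIndex.eq_sub {L₀ : Lagrangian ω}
    {μ : ∀ A B : Lagrangian ω, Path.Homotopic.Quotient A B → ℚ} (hμ : IsMaslovIndex ω L₀ μ)
    {A B : Lagrangian ω} (γ : Path A B) {F : I → ℚ}
    (hF : (maslovPrimitives L₀).IsPrimitiveAlong γ F) :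
    μ A B (Path.Homotopic.Quotient.mk γ) = F 1 - F 0 :=
  (maslovPrimitives L₀).map_mk_eq_sub hμ.map_trans hμ.eq_val_sub_val γ hF

/-- The covering is built from integer signatures and halved only afterwards, which yields
half-integrality. -/
theorem exists_isMaslovIndex (L₀ : Lagrangian ω) : ∃ μ, IsMaslovIndex ω L₀ μ := by
  obtain ⟨m, hm⟩ := (chartSignPrimitives L₀).exists_map_quotient_isPrimitiveAlong
  refine ⟨fun A B c => halfHom (m A B c), fun A B c => ⟨_, halfHom_apply _⟩, ?_, ?_⟩
  · intro A B C c d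
    obtain ⟨γ, rfl⟩ := Path.Homotopic.Quotient.mk_surjective c
    obtain ⟨δ, rfl⟩ := Path.Homotopic.Quotient.mk_surjective d
    rw [← Path.Homotopic.Quotient.mk_trans, ← map_add]
    obtain ⟨F, hF, hF'⟩ := hm _ _ (γ.trans δ)
    obtain ⟨G, hG, hG'⟩ := hm _ _ γ
    obtain ⟨H, hH, hH'⟩ := hm _ _ δ
    rw [hF', hG', hH', hF.sub_eq_of_trans hG hH]
  · intro N hN A B γ h
    obtain ⟨F, hF, hF'⟩ := hm _ _ γ
    have h1 := hF.sub_eq γ.continuous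
      (isPrimitiveAlong_val (P := chartSignPrimitives L₀) (i := ⟨N, hN⟩) h) 0 1
    rw [hF', h1, map_sub, halfHom_apply, halfHom_apply, ← chartSign_of_isCompl (h 1),
      ← chartSign_of_isCompl (h 0)]
    rfl

theorem existsUnique_isMaslovIndex (L₀ : Lagrangian ω) : ∃! μ, IsMaslovIndex ω L₀ μ := by
  obtain ⟨μ, hμ⟩ := exists_isMaslovIndex L₀
  refine ⟨μ, hμ, fun μ' hμ' => ?_⟩
  funext A B c
  obtain ⟨γ, rfl⟩ := Path.Homotopic.Quotient.mk_surjective c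
  obtain ⟨F, hF⟩ := exists_isPrimitiveAlong L₀ γ
  rw [hμ.eq_sub γ hF, hμ'.eq_sub γ hF]

variable {A B C : Lagrangian ω}

theorem isMaslovIndex_epsilon (L₀ : Lagrangian ω) :
    IsMaslovIndex ω L₀ (Classical.epsilon (IsMaslovIndex ω L₀)) :=
  Classical.epsilon_spec (exists_isMaslovIndex L₀)

theorem maslovIndex_eq_sub {L₀ : Lagrangian ω} {γ : Path A B} {F : I → ℚ}
    (hF : (maslovPrimitives L₀).IsPrimitiveAlong γ F) : maslovIndex ω L₀ γ = F 1 - F 0 :=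
  (isMaslovIndex_epsilon L₀).eq_sub γ hF

theorem maslovIndex_trans (L₀ : Lagrangian ω) (γ : Path A B) (δ : Path B C) :
    maslovIndex ω L₀ (γ.trans δ) = maslovIndex ω L₀ γ + maslovIndex ω L₀ δ :=
  (isMaslovIndex_epsilon L₀).map_trans _ _ _ (Path.Homotopic.Quotient.mk γ)
    (Path.Homotopic.Quotient.mk δ)

/-- The endpoints need not agree definitionally, so the paths are compared through a common
primitive on `I`. -/
theorem maslovIndex_congr (L₀ : Lagrangian ω) {A' B' : Lagrangian ω} {γ : Path A B}
    {δ : Path A' B'} (h : ∀ t, γ t = δ t) : maslovIndex ω L₀ γ = maslovIndex ω L₀ δ := by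
  obtain ⟨F, hF⟩ := exists_isPrimitiveAlong L₀ γ
  have hF' := hF
  rw [show (γ : I → Lagrangian ω) = δ from funext h] at hF'
  rw [maslovIndex_eq_sub hF, maslovIndex_eq_sub hF']

theorem maslovIndex_refl (L₀ : Lagrangian ω) : maslovIndex ω L₀ (Path.refl A) = 0 := by
  have h : (maslovPrimitives L₀).IsPrimitiveAlong (Path.refl A) fun _ => 0 := fun t => by
    obtain ⟨i, hi⟩ := (maslovPrimitives L₀).cover A
    exact ⟨i, hi, by simp⟩
  rw [maslovIndex_eq_sub h, sub_zero]

/-- The Maslov indices with respect to `L₀` and `L₁` differ by a function of the endpoints. -/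
theorem maslovIndex_sub_maslovIndex (L₀ L₁ : Lagrangian ω) (γ : Path A B) :
    maslovIndex ω L₁ γ - maslovIndex ω L₀ γ =
      (kashiwaraIndex L₀ L₁ A : ℚ) / 2 - (kashiwaraIndex L₀ L₁ B : ℚ) / 2 := by
  obtain ⟨F, hF⟩ := exists_isPrimitiveAlong L₀ γ
  -- Subtracting half the Kashiwara index turns a primitive for `L₀` into one for `L₁`: along `N`
  -- the discrepancy is the constant `chartSign N L₀ L₁ / 2`.
  have h : (maslovPrimitives L₁).IsPrimitiveAlong γ
      fun t => F t - (kashiwaraIndex L₀ L₁ (γ t) : ℚ) / 2 := by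
    intro t
    obtain ⟨N, hN⟩ := exists_forall_isCompl ![L₀, L₁, γ t]
    have h₀ : IsCompl L₀.space N.space := hN 0
    have h₁ : IsCompl L₁.space N.space := hN 1
    have h₂ : IsCompl (γ t).space N.space := hN 2
    refine ⟨⟨N, h₁⟩, h₂, ?_⟩
    have key : ∀ s, IsCompl (γ s).space N.space →
        F s - (kashiwaraIndex L₀ L₁ (γ s) : ℚ) / 2 - (maslovPrimitives L₁).val ⟨N, h₁⟩ (γ s) =
          F s - (maslovPrimitives L₀).val ⟨N, h₀⟩ (γ s) + (chartSign N L₀ L₁ : ℚ) / 2 := by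
      intro s hs
      rw [maslovPrimitives_val, maslovPrimitives_val, kashiwaraIndex_eq_chartSign h₀ h₁ hs,
        chartSign_antisymm h₀ hs]
      push_cast
      ring
    have hdom := γ.continuous.continuousAt.eventually
      ((Lagrangian.isOpen_setOf_isCompl N.space).mem_nhds h₂)
    filter_upwards [hdom, hF.eventually γ.continuous (i := ⟨N, h₀⟩) h₂] with s hs hs'
    rw [key s hs, key t h₂, hs']
  rw [maslovIndex_eq_sub h, maslovIndex_eq_sub hF, γ.source, γ.target]
  ring

theorem hormanderIndex_eq (L₀ L₁ : Lagrangian ω) (γ : Path A B) :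
    hormanderIndex ω L₀ L₁ A B = maslovIndex ω L₁ γ - maslovIndex ω L₀ γ :=
  Classical.epsilon_spec (p := fun r : ℚ => ∀ γ : Path A B,
    r = maslovIndex ω L₁ γ - maslovIndex ω L₀ γ)
    ⟨_, fun γ => (maslovIndex_sub_maslovIndex L₀ L₁ γ).symm⟩ γ

theorem hormanderIndex_self (L₀ : Lagrangian ω) : hormanderIndex ω L₀ L₀ A B = 0 := by
  obtain ⟨γ⟩ := A.nonempty_path B
  rw [hormanderIndex_eq L₀ L₀ γ, sub_self]

theorem hormanderIndex_self_right (L₀ L₁ : Lagrangian ω) : hormanderIndex ω L₀ L₁ A A = 0 := by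
  rw [hormanderIndex_eq L₀ L₁ (Path.refl A), maslovIndex_refl, maslovIndex_refl, sub_self]

/-- Symplectic invariance of the Maslov index. -/
theorem maslovIndex_map {g : W ≃ₗ[ℝ] W} (hg : ∀ x y, ω.form (g x) (g y) = ω.form x y)
    (L₀ : Lagrangian ω) (γ : Path A B) :
    maslovIndex ω (L₀.map g hg) (γ.map (Lagrangian.continuous_map hg)) = maslovIndex ω L₀ γ := by
  obtain ⟨F, hF⟩ := exists_isPrimitiveAlong L₀ γ
  have h : (maslovPrimitives (L₀.map g hg)).IsPrimitiveAlong
      (γ.map (Lagrangian.continuous_map hg)) F := by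
    intro t
    obtain ⟨N, hN, h⟩ := hF t
    -- Transporting the chart by `g` preserves the local values, so the same `F` serves both paths.
    refine ⟨⟨N.1.map g hg, Lagrangian.isCompl_map hg N.2⟩, Lagrangian.isCompl_map hg hN, ?_⟩
    have hdom := γ.continuous.continuousAt.eventually
      (((maslovPrimitives L₀).isOpen_dom N).mem_nhds hN)
    have key : ∀ s, γ s ∈ (maslovPrimitives L₀).dom N → (maslovPrimitives (L₀.map g hg)).val
        ⟨N.1.map g hg, Lagrangian.isCompl_map hg N.2⟩ (γ.map (Lagrangian.continuous_map hg) s) =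
          (maslovPrimitives L₀).val N (γ s) := by
      intro s hs
      rw [maslovPrimitives_val, maslovPrimitives_val, Path.map_coe, Function.comp_apply,
        Lagrangian.chartSign_map hg N.2 hs]
    filter_upwards [hdom, h] with s hs hs'
    rw [key s hs, key t hN, hs']
  rw [maslovIndex_eq_sub h, maslovIndex_eq_sub hF]

end MaslovIndex

/-! ### The product formula for the Conley–Zehnder index. -/

section ProductFormula

variable {V : Type*} [NormedAddCommGroup V] [NormedSpace ℝ V] {ω : SymplecticForm V}

/-- The action of `Sp(V, ω) × Sp(V, ω)` on `V × V`. -/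
def spProdEquiv (a b : Sp ω) : (V × V) ≃ₗ[ℝ] V × V :=
  (ContinuousLinearEquiv.ofUnit a.1).toLinearEquiv.prodCongr
    (ContinuousLinearEquiv.ofUnit b.1).toLinearEquiv

theorem spProdEquiv_apply (a b : Sp ω) (x : V × V) :
    spProdEquiv a b x = (a.1.val x.1, b.1.val x.2) := rfl

theorem double_spProdEquiv (a b : Sp ω) (x y : V × V) :
    ω.double.form (spProdEquiv a b x) (spProdEquiv a b y) = ω.double.form x y := by
  rw [SymplecticForm.double_apply, SymplecticForm.double_apply]
  exact congrArg₂ (· - ·) (a.2 _ _) (b.2 _ _)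

variable [FiniteDimensional ℝ V]

theorem map_graphLagrangian (a b φ : Sp ω) :
    (graphLagrangian ω φ).map (spProdEquiv a b) (double_spProdEquiv a b) =
      graphLagrangian ω (b * φ * a⁻¹) := by
  have h1 : ∀ v, a.1.val ((a.1⁻¹).val v) = v := fun v =>
    congrArg (fun f : V →L[ℝ] V => f v) a.1.mul_inv
  have h2 : ∀ v, (a.1⁻¹).val (a.1.val v) = v := fun v =>
    congrArg (fun f : V →L[ℝ] V => f v) a.1.inv_mul
  refine Lagrangian.ext (Submodule.ext fun x => ?_)
  change (∃ y ∈ (φ.1.val : V →ₗ[ℝ] V).graph, spProdEquiv a b y = x) ↔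
    x ∈ ((b * φ * a⁻¹).1.val : V →ₗ[ℝ] V).graph
  rw [LinearMap.mem_graph_iff]
  change _ ↔ x.2 = b.1.val (φ.1.val ((a.1⁻¹).val x.1))
  constructor
  · rintro ⟨y, hy, rfl⟩
    rw [LinearMap.mem_graph_iff] at hy
    rw [spProdEquiv_apply, hy]
    simp only [h2]
    rfl
  · intro hx
    refine ⟨((a.1⁻¹).val x.1, φ.1.val ((a.1⁻¹).val x.1)), rfl, ?_⟩
    rw [spProdEquiv_apply]
    exact Prod.ext (h1 _) hx.symm

theorem conleyZehnderIndex_mul_eq (Φ₁ Φ₂ : C(I, Sp ω)) :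
    conleyZehnderIndex ω (Φ₁ * Φ₂) =
      maslovIndex ω.double (graphLagrangian ω (Φ₂ 0)⁻¹) (graphPath ω Φ₁) +
      maslovIndex ω.double (graphLagrangian ω (Φ₁ 1)⁻¹) (graphPath ω Φ₂) := by
  let K : C(I × I, Lagrangian ω.double) := ⟨fun p => graphLagrangian ω (Φ₁ p.1 * Φ₂ p.2),
    (continuous_graphLagrangian ω).comp (by fun_prop)⟩
  let d : Path ((0, 0) : I × I) (1, 1) := ⟨⟨fun t => (t, t), by fun_prop⟩, rfl, rfl⟩
  let p : Path ((0, 0) : I × I) (1, 0) := ⟨⟨fun t => (t, 0), by fun_prop⟩, rfl, rfl⟩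
  let q : Path ((1, 0) : I × I) (1, 1) := ⟨⟨fun t => (1, t), by fun_prop⟩, rfl, rfl⟩
  have h1 : conleyZehnderIndex ω (Φ₁ * Φ₂) =
      maslovIndex ω.double (diagLagrangian ω) (d.map K.continuous) :=
    maslovIndex_congr _ fun t => rfl
  have : ContractibleSpace I := (convex_Icc (0 : ℝ) 1).contractibleSpace ⟨0, by simp⟩
  -- The square is contractible, so its diagonal is homotopic to the edge `t = 0` followed by the
  -- edge `s = 1`.
  have h2 : (d.map K.continuous).Homotopic ((p.trans q).map K.continuous) :=
    (SimplyConnectedSpace.paths_homotopic d (p.trans q)).map K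
  rw [h1, maslovIndex_eq_of_homotopic _ h2, Path.map_trans, maslovIndex_trans]
  congr 1
  -- The map `Φ₂(0)⁻¹ × 1` takes `Gr(φ)` to `Gr(φΦ₂(0))`, and in particular `Gr(Φ₂(0)⁻¹)` to `Δ`.
  · rw [← maslovIndex_map (double_spProdEquiv (Φ₂ 0)⁻¹ 1) (graphLagrangian ω (Φ₂ 0)⁻¹), map_graphLagrangian]
    simp only [inv_inv, one_mul, inv_mul_cancel]
    refine maslovIndex_congr _ fun t => ?_
    change graphLagrangian ω (Φ₁ t * Φ₂ 0) = (graphLagrangian ω (Φ₁ t)).map _ (double_spProdEquiv _ _)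
    rw [map_graphLagrangian, inv_inv, one_mul]
  · rw [← maslovIndex_map (double_spProdEquiv 1 (Φ₁ 1)) (graphLagrangian ω (Φ₁ 1)⁻¹), map_graphLagrangian]
    simp only [inv_one, mul_one, mul_inv_cancel]
    refine maslovIndex_congr _ fun t => ?_
    change graphLagrangian ω (Φ₁ 1 * Φ₂ t) = (graphLagrangian ω (Φ₂ t)).map _ (double_spProdEquiv _ _)
    rw [map_graphLagrangian, inv_one, mul_one]

theorem conleyZehnderIndex_mul (Φ₁ Φ₂ : C(I, Sp ω)) :
    conleyZehnderIndex ω (Φ₁ * Φ₂) =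
      conleyZehnderIndex ω Φ₁ + conleyZehnderIndex ω Φ₂
      + hormanderIndex ω.double (diagLagrangian ω) (graphLagrangian ω (Φ₂ 0)⁻¹)
          (graphLagrangian ω (Φ₁ 0)) (graphLagrangian ω (Φ₁ 1))
      + hormanderIndex ω.double (diagLagrangian ω) (graphLagrangian ω (Φ₁ 1)⁻¹)
          (graphLagrangian ω (Φ₂ 0)) (graphLagrangian ω (Φ₂ 1)) := by
  rw [conleyZehnderIndex_mul_eq, hormanderIndex_eq _ _ (graphPath ω Φ₁),
    hormanderIndex_eq _ _ (graphPath ω Φ₂), conleyZehnderIndex, conleyZehnderIndex]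
  ring

theorem conleyZehnderIndex_eq_zero {Φ : Path (1 : Sp ω) 1} (h : Φ.Homotopic (Path.refl 1)) :
    conleyZehnderIndex ω Φ.toContinuousMap = 0 := by
  have h1 : conleyZehnderIndex ω Φ.toContinuousMap = maslovIndex ω.double (diagLagrangian ω)
      (Φ.map (continuous_graphLagrangian ω)) := maslovIndex_congr _ fun t => rfl
  have h2 := h.map ⟨_, continuous_graphLagrangian ω⟩
  rw [h1, maslovIndex_eq_of_homotopic _ h2]
  exact maslovIndex_refl _

/-- The first correction vanishes because its reference Lagrangians coincide, the second because its
endpoints do. -/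
theorem conleyZehnderIndex_mul_of_homotopic_refl (Φ₁ : C(I, Sp ω)) {Φ₂ : Path (1 : Sp ω) 1}
    (h : Φ₂.Homotopic (Path.refl 1)) :
    conleyZehnderIndex ω (Φ₁ * Φ₂.toContinuousMap) = conleyZehnderIndex ω Φ₁ := by
  have h0 : Φ₂.toContinuousMap 0 = 1 := Φ₂.source
  have h1 : Φ₂.toContinuousMap 1 = 1 := Φ₂.target
  rw [conleyZehnderIndex_mul, conleyZehnderIndex_eq_zero h, h0, h1, inv_one,
    hormanderIndex_self_right, add_zero, add_zero, ← diagLagrangian, hormanderIndex_self, add_zero]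

end ProductFormula

end

theorem corollary3p4 {V : Type*} [NormedAddCommGroup V] [NormedSpace ℝ V] [FiniteDimensional ℝ V]
    (ω : SymplecticForm V) :
    -- the Maslov and Hörmander indices that enter the formula are well defined
    (∀ L₀ : Lagrangian ω.double, ∃! μ, IsMaslovIndex ω.double L₀ μ) ∧
    (∀ L₀ L₁ L₀' L₁' : Lagrangian ω.double, Nonempty (Path L₀' L₁') ∧
      ∀ γ : Path L₀' L₁', hormanderIndex ω.double L₀ L₁ L₀' L₁' =
        maslovIndex ω.double L₁ γ - maslovIndex ω.double L₀ γ) ∧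
    -- the product formula
    (∀ Φ₁ Φ₂ : C(unitInterval, Sp ω),
      conleyZehnderIndex ω (Φ₁ * Φ₂) =
        conleyZehnderIndex ω Φ₁ + conleyZehnderIndex ω Φ₂
        + hormanderIndex ω.double (diagLagrangian ω) (graphLagrangian ω (Φ₂ 0)⁻¹)
            (graphLagrangian ω (Φ₁ 0)) (graphLagrangian ω (Φ₁ 1))
        + hormanderIndex ω.double (diagLagrangian ω) (graphLagrangian ω (Φ₁ 1)⁻¹)
            (graphLagrangian ω (Φ₂ 0)) (graphLagrangian ω (Φ₂ 1))) ∧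
    -- multiplication by a homotopically trivial loop based at the identity
    (∀ (Φ₁ : C(unitInterval, Sp ω)) (Φ₂ : Path (1 : Sp ω) 1),
      Φ₂.Homotopic (Path.refl 1) →
      conleyZehnderIndex ω (Φ₁ * Φ₂.toContinuousMap) = conleyZehnderIndex ω Φ₁) := by
  exact ⟨existsUnique_isMaslovIndex, fun L₀ L₁ L₀' L₁' =>
    ⟨L₀'.nonempty_path L₁', fun γ => hormanderIndex_eq L₀ L₁ γ⟩, conleyZehnderIndex_mul,
    fun Φ₁ _ h => conleyZehnderIndex_mul_of_homotopic_refl Φ₁ h⟩
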